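/- Let $(\Omega,\mathcal F,\mathbb P)$ be a complete probability space with a measurable $\mathbb P$-preserving transformation $\vartheta:\Omega\to\Omega$, and let $X$ be a compact metric space with Borel $\sigma$-algebra $\mathcal B$. Let $\mathcal E\in\mathcal F\otimes\mathcal B$ be a subset of $\Omega\times X$ all of whose fibers $\mathcal E_\omega=\{x\in X:(\omega,x)\in\mathcal E\}$ are nonempty and compact. Let $T$ be a continuous bundle random dynamical system on $\mathcal E$, i.e. a family of maps $T_\omega:\mathcal E_\omega\to\mathcal E_{\vartheta\omega}$, $\omega\in\Omega$, such that $(\omega,x)\mapsto T_\omega x$ is measurable on $\mathcal E$ and $T_\omega$ is continuous for $\mathbb P$-almost every $\omega$. Put $T^0_\omega=\mathrm{id}$, $T^n_\omega=T_{\vartheta^{n-1}\omega}\circ\cdots\circ T_{\vartheta\omega}\circ T_\omega$ for $n\ge1$, and $\Theta(\omega,x)=(\vartheta\omega,T_\omega x)$ for $(\omega,x)\in\mathcal E$. Let $\mathcal I_{\mathbb P}(\mathcal E)$ be the set of probability measures $\mu$ on $\Omega\times X$ with marginal $\mathbb P$ on $\Omega$ and $\mu(\mathcal E)=1$ that are $\Theta$-invariant.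 **Proposition.** Let $E\subset X$ be closed. Then the $\omega$-orbit capacity $$\mathrm{ocap}^\omega(E)=\lim_{n\to\infty}\frac1n\sup_{x\in\mathcal E_\omega}\sum_{i=0}^{n-1}1_E(T^i_\omega x)$$ exists for $\mathbb P$-almost every $\omega$, it is $\mathbb P$-integrable as a function of $\omega$, the set $\mathcal I_{\mathbb P}(\mathcal E)$ is nonempty, and $$\int_\Omega \mathrm{ocap}^\omega(E)\,d\mathbb P(\omega)=\sup\{\mu(\Omega\times E):\mu\in\mathcal I_{\mathbb P}(\mathcal E)\}.$$ -/

import Mathlib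

open MeasureTheory Filter Topology

noncomputable section

/-- A continuous bundle random dynamical system over `(Ω, P, ϑ)` with fibers in `X`: a measurable
set `carrier ⊆ Ω × X` with nonempty compact fibers, and fiber maps `T ω` from the fiber over `ω` to
the fiber over `ϑ ω`, jointly measurable in `(ω, x)` and continuous in `x` for almost every `ω`. -/
structure BundleRDS {Ω : Type*} [MeasurableSpace Ω] (P : Measure Ω) (ϑ : Ω → Ω)
    (X : Type*) [TopologicalSpace X] [MeasurableSpace X] where
  carrier : Set (Ω × X)
  measurableSet_carrier : MeasurableSet carrier
  nonempty_fiber : ∀ ω, {x : X | (ω, x) ∈ carrier}.Nonempty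
  isCompact_fiber : ∀ ω, IsCompact {x : X | (ω, x) ∈ carrier}
  T : ∀ ω, {x : X | (ω, x) ∈ carrier} → {x : X | (ϑ ω, x) ∈ carrier}
  measurable_T : Measurable (fun p : carrier => (T p.1.1 ⟨p.1.2, p.2⟩ : X))
  continuous_T : ∀ᵐ ω ∂P, Continuous (T ω)

namespace BundleRDS

variable {Ω : Type*} [MeasurableSpace Ω] {P : Measure Ω} {ϑ : Ω → Ω}
  {X : Type*} [TopologicalSpace X] [MeasurableSpace X]

/-- The fiber of the bundle over `ω`. -/
def fiber (R : BundleRDS P ϑ X) (ω : Ω) : Set X := {x : X | (ω, x) ∈ R.carrier}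

/-- The skew product transformation `Θ (ω, x) = (ϑ ω, T_ω x)` of the bundle. -/
def skew (R : BundleRDS P ϑ X) (p : R.carrier) : R.carrier :=
  ⟨(ϑ p.1.1, (R.T p.1.1 ⟨p.1.2, p.2⟩ : X)), (R.T p.1.1 ⟨p.1.2, p.2⟩).2⟩

/-- The iterate `T_ω^n = T_{ϑ^{n-1} ω} ∘ ⋯ ∘ T_{ϑ ω} ∘ T_ω`, with `T_ω^0 = id`. -/
def iter (R : BundleRDS P ϑ X) : (n : ℕ) → (ω : Ω) → R.fiber ω → R.fiber (ϑ^[n] ω)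
  | 0, _, x => x
  | n + 1, ω, x => iter R n (ϑ ω) (R.T ω x)

/-- `(1 / n) * sup_{x ∈ fiber ω} ∑_{i < n} 1_E (T_ω^i x)`. -/
def orbitFreq (R : BundleRDS P ϑ X) (E : Set X) (n : ℕ) (ω : Ω) : ℝ :=
  (1 / (n : ℝ)) * ⨆ x : R.fiber ω,
    ∑ i ∈ Finset.range n, E.indicator (fun _ => (1 : ℝ)) (R.iter i ω x : X)

/-- The `ω`-orbit capacity of `E`: the limit of `orbitFreq` as `n → ∞`. -/
def ocap (R : BundleRDS P ϑ X) (E : Set X) (ω : Ω) : ℝ :=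
  limUnder atTop (fun n : ℕ => R.orbitFreq E n ω)

/-- The probability measures on `Ω × X` with marginal `P` on `Ω` that give full mass to the bundle
and whose restriction to the bundle is invariant under the skew product. -/
def invariantMeasures (R : BundleRDS P ϑ X) : Set (Measure (Ω × X)) :=
  {μ | IsProbabilityMeasure μ ∧ μ.map Prod.fst = P ∧ μ R.carrier = 1 ∧
    MeasurePreserving R.skew (μ.comap (Subtype.val : R.carrier → Ω × X))
      (μ.comap (Subtype.val : R.carrier → Ω × X))}

end BundleRDS

end

/-! Let `a n ω` be the largest number of visits to `E` before time `n` over the fiber of `ω`. Orbits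
stay in the bundle, so `a` is subadditive over `ϑ`, and `0 ≤ a n ≤ n`. The subadditive ergodic
theorem (`BoundedSubadditive.ae_tendsto`) gives the limit of `a n / n` almost everywhere, and
bounded convergence identifies the integral of the limit with the limit of `(∫ a n) / n`.
Completeness of `P` enters through the projection theorem `measurableSet_image_fst`, which makes `a
n` measurable, and through `exists_measurable_section`, which selects maximizing points measurably.

For an invariant `μ`, the mean number of visits before time `n` is `n * μ (Ω × E)`, and it is at
most `∫ a n`; this is the upper bound. For the converse, averaging along the orbits of a maximizing
section gives a measure that is invariant up to `2 / n` and gives `E` mass exactly `(∫ a n) / n`.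

A limit of such measures is needed, although `Ω` has no topology and `T ω` is continuous only on
fibers, for almost every `ω`. The disintegrations of the nearly invariant measures form convex sets
that shrink with the error. A least-norm argument in an `L²` space
(`exists_kernel_tendsto_of_midpoint_mem`) picks from them kernels that converge weakly on `X` for
almost every `ω`. Fiberwise weak convergence and dominated convergence make the limit invariant, and
closedness of `E` keeps its mass from dropping. The limit therefore attains the supremum. -/

noncomputable section

/-! ### Universal measurability of analytic sets -/

/-- If an open set contains the compact box `∏ [0, M i]`, it contains the set of sequences whose
first `n` coordinates are bounded by `M`, for some `n`. -/
lemma exists_forall_lt_le_subset {M : ℕ → ℕ} {V : Set (ℕ → ℕ)} (hV : IsOpen V)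
    (hK : {x : ℕ → ℕ | ∀ i, x i ≤ M i} ⊆ V) : ∃ n, {x : ℕ → ℕ | ∀ i < n, x i ≤ M i} ⊆ V := by
  have hc : IsCompact {x : ℕ → ℕ | ∀ i, x i ≤ M i} := by
    have := isCompact_univ_pi (fun i => (Set.finite_Iic (M i)).isCompact)
    convert! this using 1
    ext x; simp [Pi.le_def]
  have key : ∃ n, ∀ x ∈ {x : ℕ → ℕ | ∀ i, x i ≤ M i}, ∀ y : ℕ → ℕ,
      (∀ i < n, y i = x i) → y ∈ V := by
    refine hc.induction_on (p := fun s => ∃ n, ∀ x ∈ s, ∀ y : ℕ → ℕ, (∀ i < n, y i = x i) → y ∈ V)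
      ⟨0, by simp⟩ ?_ ?_ ?_
    · rintro s t hst ⟨n, hn⟩
      exact ⟨n, fun x hx => hn x (hst hx)⟩
    · rintro s t ⟨n, hn⟩ ⟨m, hm⟩
      refine ⟨max n m, ?_⟩
      rintro x (hx | hx) y hy
      · exact hn x hx y fun i hi => hy i (lt_of_lt_of_le hi (le_max_left _ _))
      · exact hm x hx y fun i hi => hy i (lt_of_lt_of_le hi (le_max_right _ _))
    · intro x hx
      obtain ⟨_, ⟨z, n, rfl⟩, hxU, hUV⟩ :=
        (PiNat.isTopologicalBasis_cylinders (fun _ : ℕ => ℕ)).exists_subset_of_mem_open (hK hx) hV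
      refine ⟨PiNat.cylinder z n, mem_nhdsWithin_of_mem_nhds
        ((PiNat.isOpen_cylinder _ _ _).mem_nhds hxU), n, fun w hw y hy => hUV ?_⟩
      intro i hi
      rw [hy i hi, hw i hi]
  obtain ⟨n, hn⟩ := key
  -- Truncating `y` by `M` puts it in the box without changing its first `n` coordinates.
  refine ⟨n, fun y hy => hn (fun i => min (y i) (M i)) (fun i => min_le_right _ _) y fun i hi => ?_⟩
  exact (min_eq_left (hy i hi)).symm

/-- A capacity argument. Outer measure is continuous along increasing unions of arbitrary sets, so
the coordinates can be bounded one at a time while the image keeps measure above `c`. All bounds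
together define a compact box. An open set containing the image of the box already contains the
image of a finite stage, hence has measure above `c`; outer regularity concludes. -/
lemma exists_isCompact_subset_range_lt_measure {Y : Type*} [TopologicalSpace Y] [MeasurableSpace Y]
    (μ : Measure Y) [μ.OuterRegular] {g : (ℕ → ℕ) → Y} (hg : Continuous g)
    {c : ENNReal} (hc : c < μ (Set.range g)) :
    ∃ K ⊆ Set.range g, IsCompact K ∧ c ≤ μ K := by
  have step : ∀ (k : ℕ) (D : {D : Set (ℕ → ℕ) // c < μ (g '' D)}),
      ∃ m : ℕ, c < μ (g '' (D.1 ∩ {x | x k ≤ m})) := by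
    intro k D
    have h1 : g '' D.1 = ⋃ m : ℕ, g '' (D.1 ∩ {x | x k ≤ m}) := by
      rw [← Set.image_iUnion, ← Set.inter_iUnion]
      congr 1
      refine (Set.inter_eq_left.2 fun x _ => ?_).symm
      exact Set.mem_iUnion.2 ⟨x k, le_refl (x k)⟩
    have h2 : Monotone fun m : ℕ => g '' (D.1 ∩ {x | x k ≤ m}) := by
      intro a b hab
      exact Set.image_mono (Set.inter_subset_inter_right _ fun x hx => le_trans hx hab)
    have h3 := D.2
    rw [h1, h2.measure_iUnion] at h3
    exact lt_iSup_iff.1 h3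
  choose m hm using step
  let D : ℕ → {D : Set (ℕ → ℕ) // c < μ (g '' D)} := fun n =>
    Nat.rec ⟨Set.univ, by rwa [Set.image_univ]⟩ (fun k D => ⟨D.1 ∩ {x | x k ≤ m k D}, hm k D⟩) n
  have hD : ∀ n, (D n).1 = {x | ∀ i < n, x i ≤ m i (D i)} := by
    intro n
    induction n with
    | zero => simp [D]
    | succ n ih =>
      have : (D (n + 1)).1 = (D n).1 ∩ {x | x n ≤ m n (D n)} := rfl
      rw [this, ih]
      ext x
      simp only [Set.mem_inter_iff, Set.mem_ofPred_eq, Nat.lt_succ_iff_lt_or_eq]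
      constructor
      · rintro ⟨h, h'⟩ i (hi | rfl)
        exacts [h i hi, h']
      · intro h
        exact ⟨fun i hi => h i (Or.inl hi), h n (Or.inr rfl)⟩
  refine ⟨g '' {x | ∀ i, x i ≤ m i (D i)}, Set.image_subset_range _ _, ?_, ?_⟩
  · refine IsCompact.image ?_ hg
    have := isCompact_univ_pi (fun i => (Set.finite_Iic (m i (D i))).isCompact)
    convert! this using 1
    ext x; simp [Pi.le_def]
  · rw [Set.measure_eq_iInf_isOpen]
    refine le_iInf₂ fun U hU => le_iInf fun hUo => ?_
    obtain ⟨n, hn⟩ := exists_forall_lt_le_subset (hUo.preimage hg) (Set.image_subset_iff.1 hU)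
    rw [← hD] at hn
    exact (D n).2.le.trans (measure_mono (Set.image_subset_iff.2 hn))

/-- Analytic sets are universally measurable. -/
lemma nullMeasurableSet_of_analyticSet {Y : Type*} [TopologicalSpace Y] [T2Space Y]
    [MeasurableSpace Y] [OpensMeasurableSpace Y] (μ : Measure Y) [μ.OuterRegular]
    [IsFiniteMeasure μ] {S : Set Y} (hS : AnalyticSet S) : NullMeasurableSet S μ := by
  rw [AnalyticSet] at hS
  rcases hS with rfl | ⟨g, hg, rfl⟩
  · exact nullMeasurableSet_empty
  by_cases h0 : μ (Set.range g) = 0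
  · exact NullMeasurableSet.of_null h0
  obtain ⟨u, -, hu, hlim⟩ := exists_seq_strictMono_tendsto' (pos_iff_ne_zero.2 h0)
  choose K hKS hKc hK using fun n =>
    exists_isCompact_subset_range_lt_measure μ hg (hu n).2
  have hm : MeasurableSet (⋃ n, K n) := MeasurableSet.iUnion fun n => (hKc n).measurableSet
  refine hm.nullMeasurableSet.congr (ae_eq_of_subset_of_measure_ge (Set.iUnion_subset hKS) ?_
    hm.nullMeasurableSet (measure_ne_top _ _))
  exact le_of_tendsto' hlim fun n => (hK n).trans (measure_mono (Set.subset_iUnion K n))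

/-! ### Measurable projection and selection -/

/-- A measurable subset of a product is the preimage of a measurable set under a measurable map of
the first factor into the Cantor space. -/
lemma exists_measurable_cantor_preimage {Ω X : Type*} [MeasurableSpace Ω] [MeasurableSpace X]
    {A : Set (Ω × X)} (hA : MeasurableSet A) :
    ∃ (f : Ω → ℕ → Bool) (A' : Set ((ℕ → Bool) × X)), Measurable f ∧ MeasurableSet A' ∧
      A = (fun p => (f p.1, p.2)) ⁻¹' A' := by
  classical
  have hgen : (inferInstance : MeasurableSpace (Ω × X)) =
      MeasurableSpace.generateFrom (Set.image2 (· ×ˢ ·) {s : Set Ω | MeasurableSet s}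
        {t : Set X | MeasurableSet t}) := generateFrom_prod.symm
  induction A, hA using MeasurableSpace.induction_on_inter hgen isPiSystem_prod with
  | empty => exact ⟨fun _ _ => true, ∅, measurable_const, MeasurableSet.empty, rfl⟩
  | basic t ht =>
    obtain ⟨s, hs, u, hu, rfl⟩ := ht
    refine ⟨fun ω _ => decide (ω ∈ s), {y | y 0 = true} ×ˢ u, ?_, ?_, ?_⟩
    · exact measurable_pi_lambda _ fun _ => measurable_to_bool (by simpa [Set.preimage] using hs)
    · exact (measurableSet_eq_fun (measurable_pi_apply 0) measurable_const).prod hu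
    · ext p; simp
  | compl t _ ih =>
    obtain ⟨f, A', hf, hA', rfl⟩ := ih
    exact ⟨f, A'ᶜ, hf, hA'.compl, rfl⟩
  | iUnion t _ _ ih =>
    choose f A' hf hA' h using ih
    -- Countably many Cantor codes are interleaved into one by the pairing function.
    refine ⟨fun ω k => f k.unpair.1 ω k.unpair.2,
      ⋃ n, (fun p => ((fun k => p.1 (Nat.pair n k) : ℕ → Bool), p.2)) ⁻¹' A' n, ?_, ?_, ?_⟩
    · exact measurable_pi_lambda _ fun k => (measurable_pi_apply _).comp (hf _)
    · refine MeasurableSet.iUnion fun n => (hA' n).preimage ?_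
      exact (measurable_pi_lambda _ fun k =>
        (measurable_pi_apply _).comp measurable_fst).prodMk measurable_snd
    · ext p
      simp only [Set.mem_iUnion, Set.mem_preimage, Nat.unpair_pair]
      exact exists_congr fun n => by
        conv_lhs => rw [h n]
        rfl

/-- The measurable projection theorem. -/
lemma measurableSet_image_fst {Ω X : Type*} [MeasurableSpace Ω] (P : Measure Ω) [IsFiniteMeasure P]
    [P.IsComplete] [TopologicalSpace X] [PolishSpace X] [MeasurableSpace X] [BorelSpace X]
    {A : Set (Ω × X)} (hA : MeasurableSet A) : MeasurableSet (Prod.fst '' A) := by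
  obtain ⟨f, A', hf, hA', rfl⟩ := exists_measurable_cantor_preimage hA
  have hP : PolishSpace (ℕ → Bool) := by
    let := TopologicalSpace.metrizableSpaceMetric (ℕ → Bool)
    infer_instance
  -- The projection of a Borel set in a Polish product is analytic, hence null measurable for the
  -- image of `P` under the coding map; pulling back and completeness do the rest.
  have h1 : AnalyticSet (Prod.fst '' A') := hA'.analyticSet.image_of_continuous continuous_fst
  have h2 : NullMeasurableSet (Prod.fst '' A') (P.map f) := nullMeasurableSet_of_analyticSet _ h1
  have h3 := h2.preimage (hf.quasiMeasurePreserving P)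
  have h4 : Prod.fst '' ((fun p : Ω × X => (f p.1, p.2)) ⁻¹' A') = f ⁻¹' (Prod.fst '' A') := by
    ext ω; simp
  rw [h4]
  exact h3.measurable_of_complete

/-- One refinement step of the selection: each fiber is cut down to its minimizers of `g`. The
minimum is a measurable function of `ω` because its strict sublevel sets are projections. -/
lemma exists_measurableSet_subset_argmin {Ω X : Type*} [MeasurableSpace Ω] (P : Measure Ω)
    [IsFiniteMeasure P] [P.IsComplete] [MetricSpace X] [CompactSpace X] [MeasurableSpace X]
    [BorelSpace X] {A : Set (Ω × X)} (hA : MeasurableSet A)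
    (hne : ∀ ω, {x | (ω, x) ∈ A}.Nonempty) (hc : ∀ ω, IsCompact {x | (ω, x) ∈ A})
    {g : X → ℝ} (hg : Continuous g) :
    ∃ B ⊆ A, MeasurableSet B ∧ (∀ ω, {x | (ω, x) ∈ B}.Nonempty) ∧
      (∀ ω, IsCompact {x | (ω, x) ∈ B}) ∧
      ∀ ω x y, (ω, x) ∈ B → (ω, y) ∈ B → g x = g y := by
  choose z hzA hz using fun ω => (hc ω).exists_isMinOn (hne ω) hg.continuousOn
  have hz' : ∀ ω x, (ω, x) ∈ A → g (z ω) ≤ g x := fun ω x hx => hz ω hx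
  have hm : Measurable fun ω => g (z ω) := by
    refine measurable_of_Iio fun c => ?_
    have : (fun ω => g (z ω)) ⁻¹' Set.Iio c = Prod.fst '' (A ∩ {p | g p.2 < c}) := by
      ext ω
      simp only [Set.mem_preimage, Set.mem_Iio, Set.mem_image, Set.mem_inter_iff, Set.mem_ofPred_eq,
        Prod.exists, exists_and_right, exists_eq_right]
      exact ⟨fun h => ⟨z ω, hzA ω, h⟩, fun ⟨x, hx, h⟩ => (hz' ω x hx).trans_lt h⟩
    rw [this]
    exact measurableSet_image_fst P (hA.inter
      (measurableSet_lt (hg.measurable.comp measurable_snd) measurable_const))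
  refine ⟨A ∩ {p | g p.2 = g (z p.1)}, Set.inter_subset_left, hA.inter ?_, fun ω => ⟨z ω, hzA ω, rfl⟩,
    fun ω => ?_, fun ω x y hx hy => hx.2.trans hy.2.symm⟩
  · exact measurableSet_eq_fun (hg.measurable.comp measurable_snd) (hm.comp measurable_fst)
  · exact (hc ω).inter_right (isClosed_eq hg (continuous_const (y := g (z ω))))

/-- A measurable set with nonempty compact fibers has a measurable section. -/
lemma exists_measurable_section {Ω X : Type*} [MeasurableSpace Ω] (P : Measure Ω)
    [IsFiniteMeasure P] [P.IsComplete] [MetricSpace X] [CompactSpace X] [MeasurableSpace X]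
    [BorelSpace X] {A : Set (Ω × X)} (hA : MeasurableSet A)
    (hne : ∀ ω, {x | (ω, x) ∈ A}.Nonempty) (hc : ∀ ω, IsCompact {x | (ω, x) ∈ A}) :
    ∃ s : Ω → X, Measurable s ∧ ∀ ω, (ω, s ω) ∈ A := by
  rcases isEmpty_or_nonempty Ω with hΩ | ⟨⟨ω₀⟩⟩
  · exact ⟨fun ω => hΩ.elim ω, measurable_of_empty _, fun ω => hΩ.elim ω⟩
  have : Nonempty X := ⟨(hne ω₀).some⟩
  let S := {A : Set (Ω × X) // MeasurableSet A ∧ (∀ ω, {x | (ω, x) ∈ A}.Nonempty) ∧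
    ∀ ω, IsCompact {x | (ω, x) ∈ A}}
  let d : ℕ → X → ℝ := fun n x => dist x (TopologicalSpace.denseSeq X n)
  have step : ∀ (n : ℕ) (A : S), ∃ B : S, B.1 ⊆ A.1 ∧
      ∀ ω x y, (ω, x) ∈ B.1 → (ω, y) ∈ B.1 → d n x = d n y := by
    intro n A
    obtain ⟨B, h1, h2, h3, h4, h5⟩ := exists_measurableSet_subset_argmin P A.2.1 A.2.2.1 A.2.2.2
      (g := d n) (continuous_id.dist continuous_const)
    exact ⟨⟨B, h2, h3, h4⟩, h1, h5⟩
  choose next hnext hconst using step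
  -- Distances to the points of a dense sequence are minimized one after another. The nested compact
  -- fibers have a common point, unique because these distances determine a point.
  let B : ℕ → S := fun n => Nat.rec ⟨A, hA, hne, hc⟩ (fun k A => next k A) n
  have hBs : ∀ n, (B (n + 1)).1 ⊆ (B n).1 := fun n => hnext n (B n)
  have hBc : ∀ n ω x y, (ω, x) ∈ (B (n + 1)).1 → (ω, y) ∈ (B (n + 1)).1 → d n x = d n y :=
    fun n => hconst n (B n)
  have hI : ∀ ω, (⋂ n, {x | (ω, x) ∈ (B n).1}).Nonempty := fun ω =>
    IsCompact.nonempty_iInter_of_sequence_nonempty_isCompact_isClosed _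
      (fun n x hx => hBs n hx) (fun n => (B n).2.2.1 ω) ((B 0).2.2.2 ω)
      (fun n => ((B n).2.2.2 ω).isClosed)
  choose s hs using hI
  have hs' : ∀ ω n, (ω, s ω) ∈ (B n).1 := fun ω n => Set.mem_iInter.1 (hs ω) n
  have huniq : ∀ ω x, (∀ n, (ω, x) ∈ (B n).1) → x = s ω := by
    intro ω x hx
    have h1 : ∀ n, d n x = d n (s ω) := fun n => hBc n ω x (s ω) (hx (n + 1)) (hs' ω (n + 1))
    have h2 : (fun y => dist x y) = fun y => dist (s ω) y :=
      (TopologicalSpace.denseRange_denseSeq X).equalizer (by fun_prop) (by fun_prop) (funext h1)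
    have h3 := congrFun h2 (s ω)
    simpa using h3
  refine ⟨s, fun C hC => ?_, fun ω => hs' ω 0⟩
  have : s ⁻¹' C = Prod.fst '' ((⋂ n, (B n).1) ∩ Prod.snd ⁻¹' C) := by
    ext ω
    simp only [Set.mem_preimage, Set.mem_image, Set.mem_inter_iff, Set.mem_iInter, Prod.exists,
      exists_and_right, exists_eq_right]
    constructor
    · exact fun h => ⟨s ω, hs' ω, h⟩
    · rintro ⟨x, hx, hxC⟩
      rwa [← huniq ω x hx]
  rw [this]
  exact measurableSet_image_fst P
    ((MeasurableSet.iInter fun n => (B n).2.1).inter (measurable_snd hC))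

/-! ### The subadditive ergodic theorem for bounded processes -/

/-- A subadditive process over `τ` with `0 ≤ a n ≤ n`. -/
structure BoundedSubadditive {Ω : Type*} [MeasurableSpace Ω] (τ : Ω → Ω) (a : ℕ → Ω → ℝ) :
    Prop where
  measurable : ∀ n, Measurable (a n)
  nonneg : ∀ n ω, 0 ≤ a n ω
  le : ∀ n ω, a n ω ≤ n
  add_le : ∀ m n ω, a (m + n) ω ≤ a m ω + a n (τ^[m] ω)

namespace BoundedSubadditive

variable {Ω : Type*} [MeasurableSpace Ω] {P : Measure Ω} [IsProbabilityMeasure P] {τ : Ω → Ω}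
  {a : ℕ → Ω → ℝ}

lemma div_nonneg (h : BoundedSubadditive τ a) (n : ℕ) (ω : Ω) : 0 ≤ a n ω / n :=
  _root_.div_nonneg (h.nonneg n ω) n.cast_nonneg

lemma div_le_one (h : BoundedSubadditive τ a) (n : ℕ) (ω : Ω) : a n ω / n ≤ 1 :=
  div_le_one_of_le₀ (h.le n ω) n.cast_nonneg

lemma isBoundedUnder_ge (h : BoundedSubadditive τ a) (ω : Ω) :
    IsBoundedUnder (· ≥ ·) atTop fun n : ℕ => a n ω / n :=
  isBoundedUnder_of ⟨0, fun n => h.div_nonneg n ω⟩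

lemma isBoundedUnder_le (h : BoundedSubadditive τ a) (ω : Ω) :
    IsBoundedUnder (· ≤ ·) atTop fun n : ℕ => a n ω / n :=
  isBoundedUnder_of ⟨1, fun n => h.div_le_one n ω⟩

/-- The lower growth rate of a process. -/
def _root_.lowerRate (a : ℕ → Ω → ℝ) (ω : Ω) : ℝ := liminf (fun n : ℕ => a n ω / n) atTop

lemma eventually_lt (h : BoundedSubadditive τ a) {ω : Ω} {c : ℝ} (hc : c < lowerRate a ω) :
    ∀ᶠ n : ℕ in atTop, c < a n ω / n :=
  eventually_lt_of_lt_liminf hc (h.isBoundedUnder_ge ω)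

lemma frequently_lt (h : BoundedSubadditive τ a) {ω : Ω} {c : ℝ} (hc : lowerRate a ω < c) :
    ∃ᶠ n : ℕ in atTop, a n ω / n < c :=
  frequently_lt_of_liminf_lt (h.isBoundedUnder_le ω).isCoboundedUnder_ge hc

lemma le_lowerRate (h : BoundedSubadditive τ a) {ω : Ω} {c : ℝ}
    (hc : ∀ᶠ n : ℕ in atTop, c ≤ a n ω / n) : c ≤ lowerRate a ω :=
  le_liminf_of_le (h.isBoundedUnder_le ω).isCoboundedUnder_ge hc

lemma measurable_lowerRate (h : BoundedSubadditive τ a) : Measurable (lowerRate a) :=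
  Measurable.liminf fun n => (h.measurable n).div_const _

lemma lowerRate_nonneg (h : BoundedSubadditive τ a) (ω : Ω) : 0 ≤ lowerRate a ω :=
  h.le_lowerRate (Eventually.of_forall fun n => h.div_nonneg n ω)

lemma lowerRate_le_one (h : BoundedSubadditive τ a) (ω : Ω) : lowerRate a ω ≤ 1 :=
  liminf_le_of_le (h.isBoundedUnder_ge ω) fun _ hb =>
    let ⟨n, hn⟩ := hb.exists
    hn.trans (h.div_le_one n ω)

lemma integrable (h : BoundedSubadditive τ a) (n : ℕ) : Integrable (a n) P :=
  Integrable.of_bound (h.measurable n).aestronglyMeasurable (n : ℝ) (Eventually.of_forall fun ω => by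
    rw [Real.norm_of_nonneg (h.nonneg n ω)]; exact h.le n ω)

lemma integrable_lowerRate (h : BoundedSubadditive τ a) : Integrable (lowerRate a) P :=
  Integrable.of_bound h.measurable_lowerRate.aestronglyMeasurable 1 (Eventually.of_forall fun ω => by
    rw [Real.norm_of_nonneg (h.lowerRate_nonneg ω)]; exact h.lowerRate_le_one ω)

/-- Subadditivity gives `a (n + 1) ω ≤ 1 + a n (τ ω)`, and the 1 disappears after division by `n`.
-/
lemma lowerRate_le_comp (h : BoundedSubadditive τ a) (ω : Ω) :
    lowerRate a ω ≤ lowerRate a (τ ω) := by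
  refine le_of_forall_pos_sub_le fun δ hδ => h.le_lowerRate ?_
  have h1 := (tendsto_add_atTop_nat 1).eventually
    (h.eventually_lt (show lowerRate a ω - δ / 2 < lowerRate a ω by linarith))
  have h2 : ∀ᶠ n : ℕ in atTop, 1 / ((n : ℝ) + 1) < δ / 2 :=
    tendsto_one_div_add_atTop_nhds_zero_nat.eventually (gt_mem_nhds (by linarith))
  filter_upwards [h1, h2, eventually_gt_atTop 0] with n hn1 hn2 hn
  have h3 := h.add_le 1 n ω
  have h4 := h.le 1 ω
  rw [add_comm 1 n] at h3
  simp only [Function.iterate_one, Nat.cast_one] at h3 h4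
  have hn' : (0 : ℝ) < n := by exact_mod_cast hn
  have h5 : a (n + 1) ω / ((n + 1 : ℕ) : ℝ) ≤ 1 / ((n : ℝ) + 1) + a n (τ ω) / n := by
    push_cast
    calc a (n + 1) ω / ((n : ℝ) + 1) ≤ (1 + a n (τ ω)) / ((n : ℝ) + 1) := by gcongr; linarith
      _ = 1 / ((n : ℝ) + 1) + a n (τ ω) / ((n : ℝ) + 1) := add_div _ _ _
      _ ≤ _ := by
        gcongr
        · exact h.nonneg _ _
        · linarith
  linarith

/-- The lower rate is at most its composition with `τ`, and both have the same integral, so they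
agree almost everywhere. -/
lemma ae_lowerRate_iterate (h : BoundedSubadditive τ a) (hτ : MeasurePreserving τ P P) :
    ∀ᵐ ω ∂P, ∀ i, lowerRate a (τ^[i] ω) = lowerRate a ω := by
  have h1 : ∀ᵐ ω ∂P, lowerRate a ω = lowerRate a (τ ω) := by
    have hi : Integrable (fun ω => lowerRate a (τ ω)) P :=
      (hτ.integrable_comp h.measurable_lowerRate.aestronglyMeasurable).2 h.integrable_lowerRate
    refine (integral_eq_iff_of_ae_le h.integrable_lowerRate hi
      (Eventually.of_forall h.lowerRate_le_comp)).1 ?_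
    have := integral_map (μ := P) hτ.measurable.aemeasurable
      (f := lowerRate a) h.measurable_lowerRate.aestronglyMeasurable
    rw [hτ.map_eq] at this
    exact this
  have h2 : ∀ᵐ ω ∂P, ∀ i, lowerRate a (τ^[i] ω) = lowerRate a (τ (τ^[i] ω)) :=
    ae_all_iff.2 fun i => (hτ.iterate i).quasiMeasurePreserving.ae h1
  filter_upwards [h2] with ω hω i
  induction i with
  | zero => rfl
  | succ i ih => rw [Function.iterate_succ_apply', ← hω i, ih]

/-- The points at which the averages stay above the lower rate plus `ε` up to time `N`. -/
def _root_.highSet (a : ℕ → Ω → ℝ) (ε : ℝ) (N : ℕ) : Set Ω :=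
  {ω | ∀ k, 1 ≤ k → k ≤ N → (k : ℝ) * (lowerRate a ω + ε) < a k ω}

lemma measurableSet_highSet (h : BoundedSubadditive τ a) (ε : ℝ) (N : ℕ) :
    MeasurableSet (highSet a ε N) := by
  have : highSet a ε N = ⋂ k : ℕ, ⋂ (_ : 1 ≤ k), ⋂ (_ : k ≤ N),
      {ω | (k : ℝ) * (lowerRate a ω + ε) < a k ω} := by
    ext ω; simp [highSet]
  rw [this]
  exact MeasurableSet.iInter fun k => MeasurableSet.iInter fun _ => MeasurableSet.iInter fun _ =>
    measurableSet_lt ((h.measurable_lowerRate.add_const ε).const_mul _) (h.measurable k)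

/-- The sets decrease in `N`, and by the definition of the lower limit no point lies in all of them.
-/
lemma tendsto_measure_highSet (h : BoundedSubadditive τ a) {ε : ℝ} (hε : 0 < ε) :
    Tendsto (fun N => P.real (highSet a ε N)) atTop (𝓝 0) := by
  have h1 : Antitone (highSet a ε) := fun N M hNM ω hω k hk hkN => hω k hk (hkN.trans hNM)
  have h2 : ⋂ N, highSet a ε N = ∅ := by
    refine Set.eq_empty_of_forall_notMem fun ω hω => ?_
    obtain ⟨k, hk, hk1⟩ := ((h.frequently_lt (show lowerRate a ω < lowerRate a ω + ε by
      linarith)).and_eventually (eventually_ge_atTop 1)).exists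
    have := Set.mem_iInter.1 hω k k hk1 le_rfl
    have hk' : (0 : ℝ) < k := by exact_mod_cast hk1
    rw [div_lt_iff₀ hk'] at hk
    linarith [mul_comm (k : ℝ) (lowerRate a ω + ε)]
  have h3 := tendsto_measure_iInter_atTop (μ := P)
    (fun N => (h.measurableSet_highSet ε N).nullMeasurableSet) h1 ⟨0, measure_ne_top _ _⟩
  rw [h2, measure_empty] at h3
  exact (ENNReal.tendsto_toReal ENNReal.zero_ne_top).comp h3

/-- Greedy covering of `[0, n)`: off `highSet` some block of length at most `N` has average at most
`lowerRate a ω + ε`; on `highSet` a block of length 1 costs at most 1, paid by the indicator. A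
remainder of length at most `N` costs at most `N`. -/
lemma le_of_iterate_eq (h : BoundedSubadditive τ a) {ε : ℝ} (hε : 0 ≤ ε) (N n : ℕ) (ω : Ω)
    (hω : ∀ i, lowerRate a (τ^[i] ω) = lowerRate a ω) :
    a n ω ≤ n * (lowerRate a ω + ε) +
      ∑ i ∈ Finset.range n, (highSet a ε N).indicator (fun _ => (1 : ℝ)) (τ^[i] ω) + N := by
  have hind : ∀ ω, 0 ≤ (highSet a ε N).indicator (fun _ => (1 : ℝ)) ω := fun ω =>
    Set.indicator_nonneg (fun _ _ => zero_le_one) ω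
  induction n using Nat.strong_induction_on generalizing ω with
  | _ n ih =>
    have hf := h.lowerRate_nonneg ω
    rcases le_or_gt n N with hn | hn
    · have h1 : a n ω ≤ N := (h.le n ω).trans (by exact_mod_cast hn)
      have h2 : 0 ≤ (n : ℝ) * (lowerRate a ω + ε) := by positivity
      have h3 := Finset.sum_nonneg fun i (_ : i ∈ Finset.range n) => hind (τ^[i] ω)
      linarith
    -- Splits off a first block of length `k`; the rest is handled by induction at `τ^[k] ω`, where
    -- the lower rate is the same.
    have main : ∀ k, 1 ≤ k → k ≤ n → a k ω ≤ k * (lowerRate a ω + ε) +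
        ∑ i ∈ Finset.range k, (highSet a ε N).indicator (fun _ => (1 : ℝ)) (τ^[i] ω) →
        a n ω ≤ n * (lowerRate a ω + ε) +
        ∑ i ∈ Finset.range n, (highSet a ε N).indicator (fun _ => (1 : ℝ)) (τ^[i] ω) + N := by
      intro k hk hkn hak
      obtain ⟨l, rfl⟩ := Nat.exists_eq_add_of_le hkn
      have h1 := ih l (by omega) (τ^[k] ω) fun i => by
        rw [← Function.iterate_add_apply, hω, hω]
      rw [hω] at h1
      have h2 := h.add_le k l ω
      rw [Finset.sum_range_add]
      have h3 : ∀ i, τ^[i] (τ^[k] ω) = τ^[k + i] ω := fun i => by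
        rw [← Function.iterate_add_apply, add_comm]
      simp only [h3] at h1
      push_cast
      linarith
    by_cases hB : ω ∈ highSet a ε N
    · refine main 1 le_rfl (by omega) ?_
      have h1 := h.le 1 ω
      simp only [Nat.cast_one, one_mul, Finset.range_one, Finset.sum_singleton,
        Function.iterate_zero, id, Set.indicator_of_mem hB] at h1 ⊢
      linarith
    · simp only [highSet, Set.mem_ofPred_eq, not_forall, not_lt] at hB
      obtain ⟨k, hk1, hkN, hk⟩ := hB
      refine main k hk1 (by omega) (hk.trans ?_)
      exact le_add_of_nonneg_right (Finset.sum_nonneg fun i _ => hind _)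

lemma exists_integral_le (h : BoundedSubadditive τ a) (hτ : MeasurePreserving τ P P) {ε : ℝ}
    (hε : 0 < ε) : ∃ N : ℕ, ∀ n : ℕ, ∫ ω, a n ω ∂P ≤ n * (∫ ω, lowerRate a ω ∂P + ε) + N := by
  -- One half of `ε` is spent on the rate, the other on the measure of `highSet`.
  obtain ⟨N, hN⟩ := ((h.tendsto_measure_highSet (P := P) (half_pos hε)).eventually
    (gt_mem_nhds (half_pos hε))).exists
  refine ⟨N, fun n => ?_⟩
  have hm := h.measurableSet_highSet (ε / 2) N
  have hi : ∀ i, Integrable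
      (fun ω => (highSet a (ε / 2) N).indicator (fun _ => (1 : ℝ)) (τ^[i] ω)) P := fun i =>
    ((hτ.iterate i).integrable_comp_of_integrable ((integrable_const 1).indicator hm))
  have hint : ∀ i, ∫ ω, (highSet a (ε / 2) N).indicator (fun _ => (1 : ℝ)) (τ^[i] ω) ∂P =
      P.real (highSet a (ε / 2) N) := fun i => by
    have := integral_map (μ := P) (hτ.iterate i).measurable.aemeasurable
      (f := (highSet a (ε / 2) N).indicator (fun _ => (1 : ℝ)))
      ((measurable_const.indicator hm).aestronglyMeasurable)
    rw [(hτ.iterate i).map_eq] at this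
    rw [← this, integral_indicator hm]
    simp
  have hi1 : Integrable (fun ω => n * (lowerRate a ω + ε / 2)) P :=
    (h.integrable_lowerRate.add (integrable_const _)).const_mul _
  have hi2 := integrable_finsetSum (Finset.range n) fun i _ => hi i
  have hi3 : Integrable (fun ω => n * (lowerRate a ω + ε / 2) + ∑ i ∈ Finset.range n,
      (highSet a (ε / 2) N).indicator (fun _ => (1 : ℝ)) (τ^[i] ω)) P := hi1.add hi2
  calc ∫ ω, a n ω ∂P ≤ ∫ ω, (n * (lowerRate a ω + ε / 2) + ∑ i ∈ Finset.range n,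
        (highSet a (ε / 2) N).indicator (fun _ => (1 : ℝ)) (τ^[i] ω) + N) ∂P := by
        refine integral_mono_ae (h.integrable n) (hi3.add (integrable_const _)) ?_
        filter_upwards [h.ae_lowerRate_iterate hτ] with ω hω
        exact h.le_of_iterate_eq (half_pos hε).le N n ω hω
    _ = n * (∫ ω, lowerRate a ω ∂P + ε / 2) + n * P.real (highSet a (ε / 2) N) + N := by
        rw [integral_add hi3 (integrable_const _), integral_add hi1 hi2,
          integral_const_mul, integral_add h.integrable_lowerRate (integrable_const _),
          integral_finsetSum _ fun i _ => hi i]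
        simp [hint]
    _ ≤ _ := by
        have : (n : ℝ) * P.real (highSet a (ε / 2) N) ≤ n * (ε / 2) := by gcongr
        linarith

end BoundedSubadditive

/-- An integrated form of the ergodic theorem: a function dominating the upper limit of the
Birkhoff averages of `g`, with integral at most that of `g`. -/
lemma exists_eventually_birkhoff_le {Ω : Type*} [MeasurableSpace Ω] {P : Measure Ω}
    [IsProbabilityMeasure P] {τ : Ω → Ω} (hτ : MeasurePreserving τ P P) {g : Ω → ℝ}
    (hg : Measurable g) (h0 : ∀ ω, 0 ≤ g ω) (h1 : ∀ ω, g ω ≤ 1) :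
    ∃ h : Ω → ℝ, Integrable h P ∧ ∫ ω, h ω ∂P ≤ ∫ ω, g ω ∂P ∧
      ∀ ω, ∀ ε > 0, ∀ᶠ n : ℕ in atTop,
        (∑ i ∈ Finset.range n, g (τ^[i] ω)) / n ≤ h ω + ε := by
  -- The covering bound controls means by lower limits. Applied to the additive process of `1 - g`,
  -- it controls the upper limit of the averages of `g`.
  let a : ℕ → Ω → ℝ := fun n ω => ∑ i ∈ Finset.range n, (1 - g (τ^[i] ω))
  have ha : BoundedSubadditive τ a := by
    refine ⟨fun n => ?_, fun n ω => ?_, fun n ω => ?_, fun m n ω => ?_⟩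
    · exact Finset.measurable_sum _ fun i _ =>
        measurable_const.sub (hg.comp (hτ.iterate i).measurable)
    · exact Finset.sum_nonneg fun i _ => sub_nonneg.2 (h1 _)
    · have : a n ω ≤ ∑ _i ∈ Finset.range n, (1 : ℝ) :=
        Finset.sum_le_sum fun i _ => sub_le_self (1 : ℝ) (h0 _)
      simpa using this
    · have hit : ∀ i, τ^[i] (τ^[m] ω) = τ^[m + i] ω := fun i => by
        rw [← Function.iterate_add_apply, add_comm]
      simp only [a, Finset.sum_range_add, hit, le_refl]
  have hgi : Integrable g P := Integrable.of_bound hg.aestronglyMeasurable 1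
    (Eventually.of_forall fun ω => by rw [Real.norm_of_nonneg (h0 ω)]; exact h1 ω)
  have hai : ∀ n : ℕ, ∫ ω, a n ω ∂P = n * (1 - ∫ ω, g ω ∂P) := by
    intro n
    have hgi' : ∀ i, Integrable (fun ω => g (τ^[i] ω)) P := fun i =>
      (hτ.iterate i).integrable_comp_of_integrable hgi
    have hint : ∀ i, ∫ ω, g (τ^[i] ω) ∂P = ∫ ω, g ω ∂P := fun i => by
      have := integral_map (μ := P) (hτ.iterate i).measurable.aemeasurable
        (f := g) hg.aestronglyMeasurable
      rw [(hτ.iterate i).map_eq] at this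
      exact this.symm
    have hsub : ∀ i, Integrable (fun ω => 1 - g (τ^[i] ω)) P := fun i =>
      (integrable_const _).sub (hgi' i)
    simp only [a]
    rw [integral_finsetSum _ fun i _ => hsub i]
    simp_rw [integral_sub (integrable_const _) (hgi' _), hint]
    simp only [integral_const, probReal_univ, smul_eq_mul, mul_one, Finset.sum_const,
      Finset.card_range, nsmul_eq_mul]
  refine ⟨fun ω => 1 - lowerRate a ω, (integrable_const _).sub ha.integrable_lowerRate, ?_, ?_⟩
  · rw [integral_sub (integrable_const _) ha.integrable_lowerRate]
    suffices 1 - ∫ ω, g ω ∂P ≤ ∫ ω, lowerRate a ω ∂P by simp; linarith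
    refine le_of_forall_pos_le_add fun ε hε => ?_
    obtain ⟨N, hN⟩ := ha.exists_integral_le hτ (half_pos hε)
    obtain ⟨n, hn, hn'⟩ := ((tendsto_const_div_atTop_nhds_zero_nat (N : ℝ)).eventually
      (gt_mem_nhds (half_pos hε)) |>.and (eventually_gt_atTop 0)).exists
    have hn0 : (0 : ℝ) < n := by exact_mod_cast hn'
    have h2 := hN n
    rw [hai] at h2
    rw [div_lt_iff₀ hn0] at hn
    have h3 : (n : ℝ) * (1 - ∫ ω, g ω ∂P) ≤ n * (∫ ω, lowerRate a ω ∂P + ε) := by linarith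
    exact le_of_mul_le_mul_left h3 hn0
  · intro ω ε hε
    filter_upwards [ha.eventually_lt (show lowerRate a ω - ε < lowerRate a ω by linarith),
      eventually_gt_atTop 0] with n hn hn'
    have hn0 : (n : ℝ) ≠ 0 := by exact_mod_cast hn'.ne'
    have : a n ω / n = 1 - (∑ i ∈ Finset.range n, g (τ^[i] ω)) / n := by
      simp only [a, Finset.sum_sub_distrib]
      field_simp
      simp
    linarith

namespace BoundedSubadditive

variable {Ω : Type*} [MeasurableSpace Ω] {P : Measure Ω} [IsProbabilityMeasure P] {τ : Ω → Ω}
  {a : ℕ → Ω → ℝ}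

lemma mul_le_sum (h : BoundedSubadditive τ a) (m q : ℕ) (ω : Ω) :
    a (m * q) ω ≤ ∑ j ∈ Finset.range q, a m ((τ^[m])^[j] ω) := by
  induction q with
  | zero => simpa using h.le 0 ω
  | succ q ih =>
    rw [Finset.sum_range_succ, Nat.mul_succ, ← Function.iterate_mul]
    exact (h.add_le (m * q) m ω).trans (by gcongr)

/-- Cutting `[0, n)` into blocks of length `m` bounds `a n` by a Birkhoff sum of `a m` under
`τ^[m]`, up to a remainder of at most `m`. -/
lemma exists_eventually_le (h : BoundedSubadditive τ a) (hτ : MeasurePreserving τ P P) {m : ℕ}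
    (hm : 0 < m) : ∃ f : Ω → ℝ, Integrable f P ∧ ∫ ω, f ω ∂P ≤ (∫ ω, a m ω ∂P) / m ∧
      ∀ ω, ∀ ε > 0, ∀ᶠ n : ℕ in atTop, a n ω / n ≤ f ω + ε := by
  obtain ⟨f, hf, hfi, hfe⟩ := exists_eventually_birkhoff_le (hτ.iterate m)
    ((h.measurable m).div_const (m : ℝ)) (fun ω => h.div_nonneg m ω) (fun ω => h.div_le_one m ω)
  refine ⟨f, hf, by rwa [integral_div] at hfi, fun ω ε hε => ?_⟩
  have h1 := (Nat.tendsto_div_const_atTop hm.ne').eventually (hfe ω (ε / 2) (half_pos hε))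
  have h2 := (tendsto_const_div_atTop_nhds_zero_nat (m : ℝ)).eventually
      (gt_mem_nhds (half_pos hε))
  filter_upwards [h1, h2, eventually_ge_atTop m] with n hn1 hn2 hnm
  have hm0 : (0 : ℝ) < m := by exact_mod_cast hm
  have hn0 : (0 : ℝ) < n := by exact_mod_cast hm.trans_le hnm
  have hq0 : (0 : ℝ) < ((n / m : ℕ) : ℝ) := by exact_mod_cast Nat.div_pos hnm hm
  have h3 : a n ω ≤ ∑ j ∈ Finset.range (n / m), a m ((τ^[m])^[j] ω) + m := by
    have h4 := h.add_le (m * (n / m)) (n % m) ω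
    rw [Nat.div_add_mod] at h4
    have h5 : ((n % m : ℕ) : ℝ) ≤ m := by exact_mod_cast (Nat.mod_lt n hm).le
    linarith [h.mul_le_sum m (n / m) ω, h.le (n % m) (τ^[m * (n / m)] ω)]
  have h6 : (m : ℝ) * ((n / m : ℕ) : ℝ) ≤ n := by exact_mod_cast Nat.mul_div_le n m
  have h7 : 0 ≤ ∑ j ∈ Finset.range (n / m), a m ((τ^[m])^[j] ω) :=
    Finset.sum_nonneg fun j _ => h.nonneg _ _
  rw [← Finset.sum_div, div_div] at hn1
  calc a n ω / n ≤ (∑ j ∈ Finset.range (n / m), a m ((τ^[m])^[j] ω) + m) / n := by gcongr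
    _ = (∑ j ∈ Finset.range (n / m), a m ((τ^[m])^[j] ω)) / n + m / n := add_div _ _ _
    _ ≤ (∑ j ∈ Finset.range (n / m), a m ((τ^[m])^[j] ω)) / (m * (n / m : ℕ)) + m / n := by gcongr
    _ ≤ f ω + ε := by linarith

/-- The subadditive ergodic theorem for bounded processes. -/
theorem ae_tendsto (h : BoundedSubadditive τ a) (hτ : MeasurePreserving τ P P) :
    ∀ᵐ ω ∂P, Tendsto (fun n : ℕ => a n ω / n) atTop (𝓝 (lowerRate a ω)) := by
  let F : Ω → ℝ := fun ω => limsup (fun n : ℕ => a n ω / n) atTop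
  have hFm : Measurable F := Measurable.limsup fun n => (h.measurable n).div_const _
  have hle : ∀ ω, lowerRate a ω ≤ F ω := fun ω =>
    liminf_le_limsup (h.isBoundedUnder_le ω) (h.isBoundedUnder_ge ω)
  have hF1 : ∀ ω, F ω ≤ 1 := fun ω => limsup_le_of_le (h.isBoundedUnder_ge ω).isCoboundedUnder_le
    (Eventually.of_forall fun n => h.div_le_one n ω)
  have hFi : Integrable F P := Integrable.of_bound hFm.aestronglyMeasurable 1
    (Eventually.of_forall fun ω => by
      rw [Real.norm_of_nonneg ((h.lowerRate_nonneg ω).trans (hle ω))]; exact hF1 ω)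
  -- The upper limit has integral at most `(∫ a m) / m` for every `m > 0`, and the covering bound
  -- makes this close to the integral of the lower limit for large `m`.
  have hint : ∫ ω, F ω ∂P ≤ ∫ ω, lowerRate a ω ∂P := by
    refine le_of_forall_pos_le_add fun ε hε => ?_
    obtain ⟨N, hN⟩ := h.exists_integral_le hτ (half_pos hε)
    obtain ⟨m, hm, hm'⟩ := ((tendsto_const_div_atTop_nhds_zero_nat (N : ℝ)).eventually
      (gt_mem_nhds (half_pos hε)) |>.and (eventually_gt_atTop 0)).exists
    have hm0 : (0 : ℝ) < m := by exact_mod_cast hm'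
    obtain ⟨f, hf, hfi, hfe⟩ := h.exists_eventually_le hτ hm'
    have h1 : ∀ ω, F ω ≤ f ω := fun ω => le_of_forall_pos_le_add fun δ hδ =>
      limsup_le_of_le (h.isBoundedUnder_ge ω).isCoboundedUnder_le (hfe ω δ hδ)
    have h2 : (∫ ω, a m ω ∂P) / m ≤ ∫ ω, lowerRate a ω ∂P + ε / 2 + N / m := by
      rw [div_le_iff₀ hm0]
      have := hN m
      field_simp
      field_simp at this
      linarith
    linarith [integral_mono hFi hf h1]
  have hae := (integral_eq_iff_of_ae_le h.integrable_lowerRate hFi (Eventually.of_forall hle)).1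
    (le_antisymm (integral_mono h.integrable_lowerRate hFi hle) hint)
  filter_upwards [hae] with ω hω
  exact tendsto_of_liminf_eq_limsup rfl hω.symm (h.isBoundedUnder_le ω) (h.isBoundedUnder_ge ω)

end BoundedSubadditive

/-! ### Almost sure weak limits of kernels from convexity -/

/-- Decreasing bounded midpoint-convex subsets of an inner product space contain the terms of a
Cauchy sequence. -/
lemma exists_cauchySeq_of_midpoint_mem {H : Type*} [NormedAddCommGroup H] [InnerProductSpace ℝ H]
    {C : ℕ → Set H} (hanti : Antitone C) (hne : ∀ n, (C n).Nonempty)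
    (hmid : ∀ n, ∀ x ∈ C n, ∀ y ∈ C n, (2⁻¹ : ℝ) • (x + y) ∈ C n)
    {r : ℝ} (hr : ∀ n, ∀ x ∈ C n, ‖x‖ ≤ r) :
    ∃ x : ℕ → H, (∀ n, x n ∈ C n) ∧ CauchySeq x := by
  -- Near-minimizers of the norm are chosen in each `C n`. The minima `I n` increase to a finite
  -- limit `L`, and the parallelogram law, with the midpoint in `C N`, bounds squared distances by
  -- `4 * (L - I N + 1 / (N + 1))`.
  let I : ℕ → ℝ := fun n => sInf ((fun x : H => ‖x‖ ^ 2) '' C n)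
  have hbdd : ∀ n, BddBelow ((fun x : H => ‖x‖ ^ 2) '' C n) := fun n =>
    ⟨0, by rintro _ ⟨x, -, rfl⟩; positivity⟩
  have hI : ∀ n, ∀ x ∈ C n, I n ≤ ‖x‖ ^ 2 := fun n x hx =>
    csInf_le (hbdd n) (Set.mem_image_of_mem _ hx)
  have hmono : Monotone I := fun n m hnm =>
    csInf_le_csInf (hbdd n) ((hne m).image _) (Set.image_mono (hanti hnm))
  have hIr : BddAbove (Set.range I) := by
    refine ⟨r ^ 2, ?_⟩
    rintro _ ⟨n, rfl⟩
    obtain ⟨x, hx⟩ := hne n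
    exact (hI n x hx).trans (pow_le_pow_left₀ (norm_nonneg _) (hr n x hx) 2)
  have hex : ∀ n : ℕ, ∃ x ∈ C n, ‖x‖ ^ 2 < I n + 1 / ((n : ℝ) + 1) := by
    intro n
    obtain ⟨_, ⟨x, hx, rfl⟩, hlt⟩ := exists_lt_of_csInf_lt ((hne n).image _)
      (show I n < I n + 1 / ((n : ℝ) + 1) by
        have : (0 : ℝ) < 1 / ((n : ℝ) + 1) := by positivity
        linarith)
    exact ⟨x, hx, hlt⟩
  choose x hxC hx using hex
  refine ⟨x, hxC, ?_⟩
  let L : ℝ := ⨆ n, I n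
  have hIL : ∀ n, I n ≤ L := fun n => le_ciSup hIr n
  have hlim : Tendsto I atTop (𝓝 L) := tendsto_atTop_ciSup hmono hIr
  refine cauchySeq_of_le_tendsto_0 (fun N => √(4 * (L - I N + 1 / ((N : ℝ) + 1)))) ?_ ?_
  · intro n m N hn hm
    rw [dist_eq_norm]
    refine Real.le_sqrt_of_sq_le ?_
    have h1 := parallelogram_law_with_norm ℝ (x n) (x m)
    have h2 := hI N _ (hmid N _ (hanti hn (hxC n)) _ (hanti hm (hxC m)))
    rw [norm_smul, mul_pow] at h2
    norm_num at h2
    have h3 : ∀ k, N ≤ k → ‖x k‖ ^ 2 ≤ L + 1 / ((N : ℝ) + 1) := fun k hk => by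
      have h4 : 1 / ((k : ℝ) + 1) ≤ 1 / ((N : ℝ) + 1) := by gcongr
      linarith [hx k, hIL k]
    linarith [h3 n hn, h3 m hm]
  · have h1 : Tendsto (fun N : ℕ => √(4 * (L - I N + 1 / ((N : ℝ) + 1)))) atTop
        (𝓝 (√(4 * (L - L + 0)))) :=
      (((tendsto_const_nhds.sub hlim).add tendsto_one_div_add_atTop_nhds_zero_nat).const_mul
        4).sqrt
    simpa using h1

open ProbabilityTheory BoundedContinuousFunction

/-- A family of probability measures is measurable if its integrals of bounded continuous functions
are. -/
lemma measurable_of_forall_measurable_integral {Ω X : Type*} [MeasurableSpace Ω]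
    [TopologicalSpace X] [HasOuterApproxClosed X] [MeasurableSpace X] [BorelSpace X]
    {ν : Ω → Measure X} [∀ ω, IsProbabilityMeasure (ν ω)]
    (h : ∀ f : X →ᵇ ℝ, Measurable fun ω => ∫ x, f x ∂ν ω) : Measurable ν := by
  refine Measurable.measure_of_isPiSystem_of_isProbabilityMeasure
    ((BorelSpace.measurable_eq).trans borel_eq_generateFrom_isClosed) isPiSystem_isClosed
    fun F hF => ?_
  have hF' : IsClosed F := hF
  refine measurable_of_tendsto_metrizable (f := fun n ω => ∫⁻ x, hF'.apprSeq n x ∂ν ω)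
    (fun n => ?_) (tendsto_pi_nhds.2 fun ω =>
      HasOuterApproxClosed.tendsto_lintegral_apprSeq hF' (ν ω))
  let f : X →ᵇ ℝ := BoundedContinuousFunction.comp _ NNReal.isometry_coe.lipschitz (hF'.apprSeq n)
  have : (fun ω => ∫⁻ x, hF'.apprSeq n x ∂ν ω) = fun ω => ENNReal.ofReal (∫ x, f x ∂ν ω) := by
    funext ω
    rw [ofReal_integral_eq_lintegral_ofReal (f.integrable _)
      (Eventually.of_forall fun x => NNReal.coe_nonneg _)]
    refine lintegral_congr fun x => ?_
    exact (ENNReal.ofReal_coe_nnreal).symm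
  rw [this]
  exact (h f).ennreal_ofReal

lemma abs_integral_sub_le {X : Type*} [TopologicalSpace X] [CompactSpace X]
    [MeasurableSpace X] [BorelSpace X] (μ : Measure X) [IsProbabilityMeasure μ] (f g : C(X, ℝ)) :
    |∫ x, f x ∂μ - ∫ x, g x ∂μ| ≤ ‖f - g‖ := by
  have hi : ∀ f : C(X, ℝ), Integrable f μ := fun f =>
    f.continuous.integrable_of_hasCompactSupport (HasCompactSupport.of_compactSpace _)
  rw [← integral_sub (hi f) (hi g), ← Real.norm_eq_abs]
  have := norm_integral_le_of_norm_le_const (μ := μ) (C := ‖f - g‖)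
    (Eventually.of_forall fun x => (f - g).norm_coe_le_norm x)
  simpa using this

/-- If the integrals of a dense sequence of functions converge, so does a sequence of probability
measures on a compact space. -/
lemma exists_tendsto_probabilityMeasure {X : Type*} [MetricSpace X] [CompactSpace X]
    [MeasurableSpace X] [BorelSpace X] {p : ℕ → ProbabilityMeasure X} {d : ℕ → C(X, ℝ)}
    (hd : DenseRange d) (h : ∀ j, ∃ c, Tendsto (fun n => ∫ x, d j x ∂(p n : Measure X)) atTop (𝓝 c)) :
    ∃ ν : ProbabilityMeasure X, Tendsto p atTop (𝓝 ν) := by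
  -- Compactness gives a limit along an ultrafilter; the convergent integrals of the `d j` identify
  -- it as the limit of the whole sequence.
  obtain ⟨ν, -, hν⟩ := isCompact_univ.ultrafilter_le_nhds ((hyperfilter ℕ).map p) (by simp)
  have hν' : Tendsto p (hyperfilter ℕ) (𝓝 ν) := hν
  refine ⟨ν, ProbabilityMeasure.tendsto_iff_forall_integral_tendsto.2 fun f => ?_⟩
  have hdν : ∀ j, Tendsto (fun n => ∫ x, d j x ∂(p n : Measure X)) atTop
      (𝓝 (∫ x, d j x ∂(ν : Measure X))) := by
    intro j
    obtain ⟨c, hc⟩ := h j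
    have h1 := ProbabilityMeasure.tendsto_iff_forall_integral_tendsto.1 hν'
      (BoundedContinuousFunction.mkOfCompact (d j))
    have h2 := tendsto_nhds_unique (hc.mono_left (Nat.hyperfilter_le_atTop)) h1
    rw [h2] at hc
    exact hc
  rw [Metric.tendsto_atTop]
  intro ε hε
  obtain ⟨j, hj⟩ := hd.exists_dist_lt (f.toContinuousMap) (show 0 < ε / 3 by linarith)
  rw [dist_eq_norm] at hj
  obtain ⟨N, hN⟩ := Metric.tendsto_atTop.1 (hdν j) (ε / 3) (by linarith)
  refine ⟨N, fun n hn => ?_⟩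
  have h1 := abs_integral_sub_le (p n : Measure X) f.toContinuousMap (d j)
  have h2 := abs_integral_sub_le (ν : Measure X) f.toContinuousMap (d j)
  have h3 := hN n hn
  rw [Real.dist_eq] at h3 ⊢
  change |∫ x, f.toContinuousMap x ∂(p n : Measure X) - ∫ x, f.toContinuousMap x ∂(ν : Measure X)| < ε
  rw [abs_lt] at h3 ⊢
  rw [abs_le] at h1 h2
  constructor <;> linarith [h1.1, h1.2, h2.1, h2.2, h3.1, h3.2]

/-- A sequence of Markov kernels to a compact space whose integrals of a dense sequence of functions
converge almost everywhere converges weakly to a Markov kernel almost everywhere. -/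
lemma exists_kernel_tendsto {Ω X : Type*} [MeasurableSpace Ω] {P : Measure Ω} [MetricSpace X]
    [CompactSpace X] [MeasurableSpace X] [BorelSpace X] {κ : ℕ → Kernel Ω X}
    [∀ n, IsMarkovKernel (κ n)] {d : ℕ → C(X, ℝ)} (hd : DenseRange d)
    (h : ∀ᵐ ω ∂P, ∀ j, ∃ c, Tendsto (fun n => ∫ x, d j x ∂κ n ω) atTop (𝓝 c)) :
    ∃ η : Kernel Ω X, IsMarkovKernel η ∧ ∀ᵐ ω ∂P, ∀ f : C(X, ℝ),
      Tendsto (fun n => ∫ x, f x ∂κ n ω) atTop (𝓝 (∫ x, f x ∂η ω)) := by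
  classical
  let G : Set Ω := {ω | ∀ j, ∃ c, Tendsto (fun n => ∫ x, d j x ∂κ n ω) atTop (𝓝 c)}
  have hG : MeasurableSet G := by
    have : G = ⋂ j, {ω | ∃ c, Tendsto (fun n => ∫ x, d j x ∂κ n ω) atTop (𝓝 c)} := by
      ext ω; simp [G]
    rw [this]
    exact MeasurableSet.iInter fun j => measurableSet_exists_tendsto fun n =>
      ((d j).continuous.stronglyMeasurable.integral_kernel).measurable
  -- Off the convergence set the sequence is made constant, so that a limit exists at every `ω` and
  -- is measurable.
  let κ' : ℕ → Kernel Ω X := fun n => Kernel.piecewise hG (κ n) (κ 0)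
  have hκG : ∀ n, ∀ ω ∈ G, κ' n ω = κ n ω := fun n ω hω => by
    simp [κ', Kernel.piecewise_apply, hω]
  have hκG' : ∀ n, ∀ ω ∉ G, κ' n ω = κ 0 ω := fun n ω hω => by
    simp [κ', Kernel.piecewise_apply, hω]
  let p : ℕ → Ω → ProbabilityMeasure X := fun n ω => ⟨κ' n ω, inferInstance⟩
  have hp : ∀ ω, ∃ ν : ProbabilityMeasure X, Tendsto (fun n => p n ω) atTop (𝓝 ν) := by
    intro ω
    refine exists_tendsto_probabilityMeasure hd fun j => ?_
    change ∃ c, Tendsto (fun n => ∫ x, d j x ∂κ' n ω) atTop (𝓝 c)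
    by_cases hω : ω ∈ G
    · simpa only [hκG _ ω hω] using hω j
    · simpa only [hκG' _ ω hω] using ⟨_, tendsto_const_nhds⟩
  choose ν hν using hp
  have hν' : ∀ ω, ∀ f : X →ᵇ ℝ, Tendsto (fun n => ∫ x, f x ∂κ' n ω) atTop
      (𝓝 (∫ x, f x ∂(ν ω : Measure X))) := fun ω =>
    ProbabilityMeasure.tendsto_iff_forall_integral_tendsto.1 (hν ω)
  have hm : Measurable fun ω => (ν ω : Measure X) := by
    refine measurable_of_forall_measurable_integral fun f => ?_
    refine measurable_of_tendsto_metrizable (f := fun n ω => ∫ x, f x ∂κ' n ω)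
      (fun n => ?_) (tendsto_pi_nhds.2 fun ω => hν' ω f)
    exact (f.continuous.stronglyMeasurable.integral_kernel).measurable
  refine ⟨⟨fun ω => ν ω, hm⟩, ⟨fun ω => inferInstanceAs (IsProbabilityMeasure (ν ω : Measure X))⟩, ?_⟩
  filter_upwards [h] with ω hω f
  have := hν' ω (BoundedContinuousFunction.mkOfCompact f)
  simp only [hκG _ ω hω] at this
  exact this

/-- Decreasing midpoint-convex sets of Markov kernels to a compact space contain the terms of a
sequence that converges weakly almost everywhere. -/
theorem exists_kernel_tendsto_of_midpoint_mem {Ω X : Type*} [MeasurableSpace Ω] (P : Measure Ω)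
    [IsProbabilityMeasure P] [MetricSpace X] [CompactSpace X] [MeasurableSpace X] [BorelSpace X]
    {K : ℕ → Set (Kernel Ω X)} (hanti : Antitone K) (hne : ∀ n, (K n).Nonempty)
    (hmark : ∀ n, ∀ κ ∈ K n, IsMarkovKernel κ)
    (hmid : ∀ n, ∀ κ ∈ K n, ∀ η ∈ K n, ∃ ζ ∈ K n, ∀ ω, ζ ω = (2⁻¹ : ENNReal) • (κ ω + η ω)) :
    ∃ κ : ℕ → Kernel Ω X, (∀ n, κ n ∈ K n) ∧ ∃ η : Kernel Ω X, IsMarkovKernel η ∧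
      ∀ᵐ ω ∂P, ∀ f : C(X, ℝ), Tendsto (fun n => ∫ x, f x ∂κ n ω) atTop (𝓝 (∫ x, f x ∂η ω)) := by
  let d : ℕ → C(X, ℝ) := TopologicalSpace.denseSeq C(X, ℝ)
  let w : ℕ → ℝ := fun j => (1 + ‖d j‖)⁻¹
  have hw : ∀ j, 0 < w j := fun j => by positivity
  -- A finite measure with the null sets of counting measure. With the weights `w`, a Markov kernel
  -- is encoded as a function bounded by 1 in `L²(P × W)`, and midpoints go to midpoints.
  let W : Measure ℕ := (Measure.count : Measure ℕ).toFinite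
  let u : Kernel Ω X → Ω × ℕ → ℝ := fun κ q => w q.2 * ∫ x, d q.2 x ∂κ q.1
  have hum : ∀ κ, Measurable (u κ) := fun κ =>
    measurable_from_prod_countable_left fun j =>
      (((d j).continuous.stronglyMeasurable.integral_kernel (κ := κ)).measurable).const_mul (w j)
  have hub : ∀ κ, IsMarkovKernel κ → ∀ q, ‖u κ q‖ ≤ 1 := by
    intro κ hκ q
    have h1 : ‖∫ x, d q.2 x ∂κ q.1‖ ≤ ‖d q.2‖ := by
      have := norm_integral_le_of_norm_le_const (μ := κ q.1) (C := ‖d q.2‖)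
        (Eventually.of_forall fun x => (d q.2).norm_coe_le_norm x)
      simpa using this
    rw [norm_mul, Real.norm_of_nonneg (hw _).le]
    calc w q.2 * ‖∫ x, d q.2 x ∂κ q.1‖ ≤ w q.2 * (1 + ‖d q.2‖) := by
          have := (hw q.2).le
          gcongr
          linarith
      _ = 1 := inv_mul_cancel₀ (by positivity)
  have hLp : ∀ κ, IsMarkovKernel κ → MemLp (u κ) 2 (P.prod W) := fun κ hκ =>
    MemLp.of_bound (hum κ).aestronglyMeasurable 1 (Eventually.of_forall (hub κ hκ))
  let C : ℕ → Set (Lp ℝ 2 (P.prod W)) := fun n => {v | ∃ κ ∈ K n, v =ᵐ[P.prod W] u κ}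
  obtain ⟨v, hvC, hvcau⟩ := exists_cauchySeq_of_midpoint_mem (C := C)
    (r := (measureUnivNNReal (P.prod W) : ℝ) ^ (2 : ENNReal).toReal⁻¹ * 1)
    (fun n m hnm v ⟨κ, hκ, hv⟩ => ⟨κ, hanti hnm hκ, hv⟩)
    (fun n => by
      obtain ⟨κ, hκ⟩ := hne n
      exact ⟨(hLp κ (hmark n κ hκ)).toLp, κ, hκ, MemLp.coeFn_toLp _⟩)
    (by
      rintro n v ⟨κ, hκ, hv⟩ v' ⟨η, hη, hv'⟩
      obtain ⟨ζ, hζ, hζe⟩ := hmid n κ hκ η hη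
      refine ⟨ζ, hζ, ?_⟩
      filter_upwards [hv, hv', Lp.coeFn_smul (2⁻¹ : ℝ) (v + v'), Lp.coeFn_add v v']
        with q h1 h2 h3 h4
      have := hmark n κ hκ
      have := hmark n η hη
      have hi : ∀ μ : Measure X, IsProbabilityMeasure μ → Integrable (d q.2) μ := fun μ _ =>
        (d q.2).continuous.integrable_of_hasCompactSupport (HasCompactSupport.of_compactSpace _)
      rw [h3, Pi.smul_apply, h4, Pi.add_apply, h1, h2]
      simp only [u, hζe]
      rw [integral_smul_measure, integral_add_measure (hi _ inferInstance) (hi _ inferInstance)]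
      simp only [smul_eq_mul, ENNReal.toReal_inv, ENNReal.toReal_ofNat]
      ring)
    (by
      rintro n v ⟨κ, hκ, hv⟩
      refine Lp.norm_le_of_ae_bound zero_le_one ?_
      filter_upwards [hv] with q hq
      rw [hq]
      exact hub κ (hmark n κ hκ) q)
  choose κ hκ hvκ using hvC
  obtain ⟨V, hV⟩ := cauchySeq_tendsto_of_complete hvcau
  obtain ⟨φ, hφ, hae⟩ := (tendstoInMeasure_of_tendsto_Lp hV).exists_seq_tendsto_ae
  have hmk : ∀ n, IsMarkovKernel (κ (φ n)) := fun n => hmark _ _ (hκ _)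
  -- Since `n ≤ φ n`, the subsequence still has its `n`-th term in `K n`.
  refine ⟨fun n => κ (φ n), fun n => hanti (hφ.id_le n) (hκ _), ?_⟩
  refine exists_kernel_tendsto (κ := fun n => κ (φ n)) (d := d)
    (TopologicalSpace.denseRange_denseSeq _) ?_
  have hae' : ∀ᵐ q ∂P.prod W, ∃ c, Tendsto (fun n => u (κ (φ n)) q) atTop (𝓝 c) := by
    filter_upwards [hae, ae_all_iff.2 fun n => hvκ (φ n)] with q h1 h2
    exact ⟨V q, by simpa only [h2] using h1⟩
  filter_upwards [Measure.ae_ae_of_ae_prod hae'] with ω hω j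
  have hω' : ∀ j, ∃ c, Tendsto (fun n => u (κ (φ n)) (ω, j)) atTop (𝓝 c) := by
    have h1 : ∀ᵐ j ∂(Measure.count : Measure ℕ),
        ∃ c, Tendsto (fun n => u (κ (φ n)) (ω, j)) atTop (𝓝 c) := by
      rw [← ae_toFinite (μ := (Measure.count : Measure ℕ))]
      exact hω
    rw [ae_iff, Measure.count_eq_zero_iff] at h1
    intro j
    by_contra hj
    exact (Set.eq_empty_iff_forall_notMem.1 h1 j) hj
  obtain ⟨c, hc⟩ := hω' j
  refine ⟨(w j)⁻¹ * c, ?_⟩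
  have := hc.const_mul (w j)⁻¹
  simpa [u, inv_mul_cancel_left₀ (hw j).ne'] using this

/-! ### Visit counts and the upper bound -/

/-- A bundle random dynamical system whose fiber maps are extended to a measurable map on the whole
product space. -/
structure TotalRDS {Ω : Type*} [MeasurableSpace Ω] (P : Measure Ω) (ϑ : Ω → Ω)
    (X : Type*) [TopologicalSpace X] [MeasurableSpace X] where
  carrier : Set (Ω × X)
  measurableSet_carrier : MeasurableSet carrier
  nonempty_fiber : ∀ ω, {x : X | (ω, x) ∈ carrier}.Nonempty
  isCompact_fiber : ∀ ω, IsCompact {x : X | (ω, x) ∈ carrier}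
  T : Ω × X → X
  measurable_T : Measurable T
  mapsTo : ∀ p ∈ carrier, (ϑ p.1, T p) ∈ carrier
  continuousOn_T : ∀ᵐ ω ∂P, ContinuousOn (fun x => T (ω, x)) {x : X | (ω, x) ∈ carrier}

namespace TotalRDS

variable {Ω : Type*} [MeasurableSpace Ω] {P : Measure Ω} {ϑ : Ω → Ω} {X : Type*}

section Basic

variable [TopologicalSpace X] [MeasurableSpace X] (R : TotalRDS P ϑ X)

/-- The skew product on the product space. -/
def skew (p : Ω × X) : Ω × X := (ϑ p.1, R.T p)

/-- The number of visits to `E` before time `n`. -/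
def visits (E : Set X) (n : ℕ) (p : Ω × X) : ℝ :=
  ∑ i ∈ Finset.range n, E.indicator (fun _ => (1 : ℝ)) (R.skew^[i] p).2

/-- The maximal number of visits to `E` before time `n` over a fiber. -/
def maxVisits (E : Set X) (n : ℕ) (ω : Ω) : ℝ :=
  ⨆ x : {x : X | (ω, x) ∈ R.carrier}, R.visits E n (ω, x)

lemma measurable_skew (hϑ : Measurable ϑ) : Measurable R.skew :=
  (hϑ.comp measurable_fst).prodMk R.measurable_T

lemma skew_mem {p : Ω × X} (hp : p ∈ R.carrier) : R.skew p ∈ R.carrier := R.mapsTo p hp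

lemma iterate_skew_mem {p : Ω × X} (hp : p ∈ R.carrier) (i : ℕ) : R.skew^[i] p ∈ R.carrier := by
  induction i with
  | zero => exact hp
  | succ i ih => rw [Function.iterate_succ_apply']; exact R.skew_mem ih

lemma iterate_skew_fst (p : Ω × X) (i : ℕ) : (R.skew^[i] p).1 = ϑ^[i] p.1 := by
  induction i with
  | zero => rfl
  | succ i ih => rw [Function.iterate_succ_apply', Function.iterate_succ_apply', ← ih]; rfl

variable {R} (E : Set X)

lemma visits_nonneg (n : ℕ) (p : Ω × X) : 0 ≤ R.visits E n p :=
  Finset.sum_nonneg fun _ _ => Set.indicator_nonneg (fun _ _ => zero_le_one) _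

lemma visits_le (n : ℕ) (p : Ω × X) : R.visits E n p ≤ n := by
  have : R.visits E n p ≤ ∑ _i ∈ Finset.range n, (1 : ℝ) :=
    Finset.sum_le_sum fun i _ => Set.indicator_le_self' (fun _ _ => zero_le_one) _
  simpa using this

lemma visits_add (m n : ℕ) (p : Ω × X) :
    R.visits E (m + n) p = R.visits E m p + R.visits E n (R.skew^[m] p) := by
  have hit : ∀ i, R.skew^[i] (R.skew^[m] p) = R.skew^[m + i] p := fun i => by
    rw [← Function.iterate_add_apply, add_comm]
  simp only [visits, Finset.sum_range_add, hit]

lemma measurable_visits (hϑ : Measurable ϑ) {E : Set X} (hE : MeasurableSet E) (n : ℕ) :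
    Measurable (R.visits E n) :=
  Finset.measurable_sum _ fun i _ => (measurable_const.indicator hE).comp
    (measurable_snd.comp ((R.measurable_skew hϑ).iterate i))

lemma visits_le_maxVisits (n : ℕ) {p : Ω × X} (hp : p ∈ R.carrier) :
    R.visits E n p ≤ R.maxVisits E n p.1 :=
  le_ciSup (f := fun x : {x : X | (p.1, x) ∈ R.carrier} => R.visits E n (p.1, x))
    ⟨n, by rintro _ ⟨x, rfl⟩; exact visits_le E n _⟩ ⟨p.2, hp⟩

lemma maxVisits_le {n : ℕ} {ω : Ω} {c : ℝ} (h : ∀ x, (ω, x) ∈ R.carrier → R.visits E n (ω, x) ≤ c) :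
    R.maxVisits E n ω ≤ c :=
  have : Nonempty {x : X | (ω, x) ∈ R.carrier} := (R.nonempty_fiber ω).to_subtype
  ciSup_le fun x => h x x.2

/-- Preservation of `P` allows continuity of the fiber map to be assumed at all `ϑ^[i] ω` at once;
orbits stay in the fibers, so the maps compose. -/
lemma ae_continuousOn_iterate (hϑ : MeasurePreserving ϑ P P) :
    ∀ᵐ ω ∂P, ∀ i, ContinuousOn (fun x => (R.skew^[i] (ω, x)).2) {x : X | (ω, x) ∈ R.carrier} := by
  have h : ∀ᵐ ω ∂P, ∀ i, ContinuousOn (fun x => R.T (ϑ^[i] ω, x))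
      {x : X | (ϑ^[i] ω, x) ∈ R.carrier} :=
    ae_all_iff.2 fun i => (hϑ.iterate i).quasiMeasurePreserving.ae R.continuousOn_T
  filter_upwards [h] with ω hω i
  induction i with
  | zero => exact continuousOn_id
  | succ i ih =>
    have h1 : ∀ x, R.skew^[i] (ω, x) = (ϑ^[i] ω, (R.skew^[i] (ω, x)).2) := fun x =>
      Prod.ext (R.iterate_skew_fst _ i) rfl
    have h2 : ∀ x, (R.skew^[i + 1] (ω, x)).2 = R.T (ϑ^[i] ω, (R.skew^[i] (ω, x)).2) := fun x => by
      rw [Function.iterate_succ_apply', ← h1]; rfl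
    simp only [h2]
    refine (hω i).comp ih fun x hx => ?_
    change (ϑ^[i] ω, (R.skew^[i] (ω, x)).2) ∈ R.carrier
    rw [← h1]
    exact R.iterate_skew_mem hx i

lemma ae_upperSemicontinuousOn_visits (hϑ : MeasurePreserving ϑ P P) {E : Set X}
    (hE : IsClosed E) : ∀ᵐ ω ∂P, ∀ n, UpperSemicontinuousOn (fun x => R.visits E n (ω, x))
      {x : X | (ω, x) ∈ R.carrier} := by
  filter_upwards [R.ae_continuousOn_iterate hϑ] with ω hω n
  refine upperSemicontinuousOn_sum fun i _ x hx y hy => ?_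
  exact (hω i x hx).eventually
    (hE.upperSemicontinuous_indicator (zero_le_one (α := ℝ)) (R.skew^[i] (ω, x)).2 y hy)

end Basic

variable [MetricSpace X] [CompactSpace X] [MeasurableSpace X] [BorelSpace X]
  {R : TotalRDS P ϑ X} {E : Set X}

/-- The strict superlevel sets are projections of measurable subsets of the bundle. -/
lemma measurable_maxVisits [IsFiniteMeasure P] [P.IsComplete] (hϑ : Measurable ϑ)
    (hE : MeasurableSet E) (n : ℕ) : Measurable (R.maxVisits E n) := by
  refine measurable_of_Ioi fun c => ?_
  have : R.maxVisits E n ⁻¹' Set.Ioi c = Prod.fst '' (R.carrier ∩ R.visits E n ⁻¹' Set.Ioi c) := by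
    ext ω
    constructor
    · intro h
      by_contra hcon
      refine not_le_of_gt (show c < R.maxVisits E n ω from h) (maxVisits_le E fun x hx => ?_)
      by_contra hlt
      exact hcon ⟨(ω, x), ⟨hx, not_le.1 hlt⟩, rfl⟩
    · rintro ⟨p, ⟨hp, hpc⟩, rfl⟩
      exact lt_of_lt_of_le hpc (visits_le_maxVisits E n hp)
  rw [this]
  exact measurableSet_image_fst P
    (R.measurableSet_carrier.inter (measurable_visits hϑ hE n measurableSet_Ioi))

lemma boundedSubadditive_maxVisits [IsFiniteMeasure P] [P.IsComplete] (hϑ : Measurable ϑ)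
    (hE : MeasurableSet E) : BoundedSubadditive ϑ (R.maxVisits E) where
  measurable := measurable_maxVisits hϑ hE
  nonneg n ω := Real.iSup_nonneg fun _ => visits_nonneg E n _
  le n ω := maxVisits_le E fun _ _ => visits_le E n _
  add_le m n ω := maxVisits_le E fun x hx => by
    rw [visits_add]
    have h1 := visits_le_maxVisits E m hx
    have h2 := visits_le_maxVisits E n (R.iterate_skew_mem hx m)
    rw [iterate_skew_fst] at h2
    exact add_le_add h1 h2

/-- A measurable choice of points with the maximal number of visits. -/
lemma exists_section_maxVisits [IsFiniteMeasure P] [P.IsComplete] (hϑ : MeasurePreserving ϑ P P)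
    (hE : IsClosed E) (n : ℕ) : ∃ s : Ω → X, Measurable s ∧ (∀ ω, (ω, s ω) ∈ R.carrier) ∧
      ∀ᵐ ω ∂P, R.visits E n (ω, s ω) = R.maxVisits E n ω := by
  have hae := R.ae_upperSemicontinuousOn_visits hϑ hE
  -- On this null set, where semicontinuity may fail, the whole fiber is kept. Elsewhere the
  -- maximizers form a nonempty compact set.
  let B : Set Ω := {ω | ∀ n, UpperSemicontinuousOn (fun x => R.visits E n (ω, x))
      {x : X | (ω, x) ∈ R.carrier}}ᶜ
  have hB : MeasurableSet B := (NullMeasurableSet.of_null hae).measurable_of_complete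
  let A : Set (Ω × X) := R.carrier ∩
    (Prod.fst ⁻¹' B ∪ {p | R.maxVisits E n p.1 ≤ R.visits E n p})
  have hA : MeasurableSet A := R.measurableSet_carrier.inter ((measurable_fst hB).union
    (measurableSet_le ((measurable_maxVisits hϑ.measurable hE.measurableSet n).comp measurable_fst)
      (measurable_visits hϑ.measurable hE.measurableSet n)))
  have hfib : ∀ ω, ω ∈ B → {x | (ω, x) ∈ A} = {x : X | (ω, x) ∈ R.carrier} := fun ω hω => by
    ext x; simp [A, hω]
  have hfib' : ∀ ω, ω ∉ B → {x | (ω, x) ∈ A} = {x : X | (ω, x) ∈ R.carrier} ∩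
      (fun x => R.visits E n (ω, x)) ⁻¹' Set.Ici (R.maxVisits E n ω) := fun ω hω => by
    ext x; simp [A, hω]
  have husc : ∀ ω, ω ∉ B → UpperSemicontinuousOn (fun x => R.visits E n (ω, x))
      {x : X | (ω, x) ∈ R.carrier} := fun ω hω => (Set.notMem_compl_iff.1 hω) n
  obtain ⟨s, hs, hsA⟩ := exists_measurable_section P hA
    (fun ω => by
      by_cases hω : ω ∈ B
      · rw [hfib ω hω]; exact R.nonempty_fiber ω
      · obtain ⟨x, hx, hmax⟩ := (husc ω hω).exists_isMaxOn (R.nonempty_fiber ω)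
          (R.isCompact_fiber ω)
        rw [hfib' ω hω]
        exact ⟨x, hx, maxVisits_le E fun y hy => hmax hy⟩)
    (fun ω => by
      by_cases hω : ω ∈ B
      · rw [hfib ω hω]; exact R.isCompact_fiber ω
      · rw [hfib' ω hω]
        exact (husc ω hω).isCompact_inter_preimage_Ici (R.isCompact_fiber ω) _)
  refine ⟨s, hs, fun ω => (hsA ω).1, ?_⟩
  filter_upwards [hae] with ω hω
  refine le_antisymm (visits_le_maxVisits E n (hsA ω).1) ((hsA ω).2.resolve_left fun h => h hω)

/-- The upper bound: an invariant measure gives `E` at most the normalized mean number of visits. -/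
lemma measureReal_le_integral_maxVisits [IsProbabilityMeasure P] [P.IsComplete]
    (hϑ : Measurable ϑ) (hE : MeasurableSet E) {μ : Measure (Ω × X)} [IsProbabilityMeasure μ]
    (hfst : μ.map Prod.fst = P) (hc : ∀ᵐ p ∂μ, p ∈ R.carrier) (hμ : MeasurePreserving R.skew μ μ)
    (n : ℕ) : n * μ.real (Set.univ ×ˢ E) ≤ ∫ ω, R.maxVisits E n ω ∂P := by
  have hb := R.boundedSubadditive_maxVisits hϑ hE
  have hset : (Set.univ ×ˢ E : Set (Ω × X)) = Prod.snd ⁻¹' E := by ext; simp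
  have hm : Measurable fun p : Ω × X => E.indicator (fun _ => (1 : ℝ)) p.2 :=
    (measurable_const.indicator hE).comp measurable_snd
  have hi : Integrable (fun p : Ω × X => E.indicator (fun _ => (1 : ℝ)) p.2) μ :=
    Integrable.of_bound hm.aestronglyMeasurable 1 (Eventually.of_forall fun p => by
      by_cases hp : p.2 ∈ E <;> simp [hp])
  have hint : ∫ p : Ω × X, E.indicator (fun _ => (1 : ℝ)) p.2 ∂μ = μ.real (Set.univ ×ˢ E) := by
    rw [hset, ← integral_indicator_one (measurable_snd hE)]
    rfl
  have hiter : ∀ i, ∫ p : Ω × X, E.indicator (fun _ => (1 : ℝ)) (R.skew^[i] p).2 ∂μ =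
      μ.real (Set.univ ×ˢ E) := fun i => by
    have := integral_map (μ := μ) (hμ.iterate i).measurable.aemeasurable hm.aestronglyMeasurable
    rw [(hμ.iterate i).map_eq, hint] at this
    exact this.symm
  have hii : ∀ i, Integrable (fun p : Ω × X => E.indicator (fun _ => (1 : ℝ)) (R.skew^[i] p).2) μ :=
    fun i => (hμ.iterate i).integrable_comp_of_integrable hi
  -- By invariance each of the `n` summands has integral `μ (Ω × E)`.
  have hv : ∫ p, R.visits E n p ∂μ = n * μ.real (Set.univ ×ˢ E) := by
    simp only [visits]
    rw [integral_finsetSum _ fun i _ => hii i]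
    simp [hiter]
  have hmp : MeasurePreserving (Prod.fst : Ω × X → Ω) μ P := ⟨measurable_fst, hfst⟩
  have hmax : ∫ p : Ω × X, R.maxVisits E n p.1 ∂μ = ∫ ω, R.maxVisits E n ω ∂P := by
    have := integral_map (μ := μ) measurable_fst.aemeasurable
      (hb.measurable n).aestronglyMeasurable
    rw [hfst] at this
    exact this.symm
  rw [← hv, ← hmax]
  refine integral_mono_ae (integrable_finsetSum _ fun i _ => hii i)
    (hmp.integrable_comp_of_integrable (hb.integrable n)) ?_
  filter_upwards [hc] with p hp
  exact visits_le_maxVisits E n hp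

end TotalRDS

/-! ### Empirical measures and nearly invariant kernels -/

namespace TotalRDS

open ProbabilityTheory

section Kernel

variable {Ω X : Type*} [MeasurableSpace Ω] {P : Measure Ω} [MeasurableSpace X]

lemma norm_integral_kernel_le {κ : Kernel Ω X} [IsMarkovKernel κ] {f : Ω × X → ℝ} {c : ℝ}
    (hc : ∀ p, ‖f p‖ ≤ c) (ω : Ω) : ‖∫ x, f (ω, x) ∂κ ω‖ ≤ c := by
  have := norm_integral_le_of_norm_le_const (μ := κ ω) (f := fun x => f (ω, x)) (C := c)
    (Eventually.of_forall fun x => hc _)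
  simpa using this

lemma measurable_integral_kernel {κ : Kernel Ω X} [IsMarkovKernel κ] {f : Ω × X → ℝ}
    (hf : Measurable f) : Measurable fun ω => ∫ x, f (ω, x) ∂κ ω :=
  (hf.stronglyMeasurable.integral_kernel_prod_right' (κ := κ)).measurable

lemma integrable_integral_kernel [IsFiniteMeasure P] {κ : Kernel Ω X} [IsMarkovKernel κ]
    {f : Ω × X → ℝ} (hf : Measurable f) {c : ℝ} (hc : ∀ p, ‖f p‖ ≤ c) :
    Integrable (fun ω => ∫ x, f (ω, x) ∂κ ω) P :=
  Integrable.of_bound (measurable_integral_kernel hf).aestronglyMeasurable c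
    (Eventually.of_forall fun ω => norm_integral_kernel_le hc ω)

lemma setIntegral_integral_kernel [IsFiniteMeasure P] {κ : Kernel Ω X} [IsMarkovKernel κ]
    {f : Ω × X → ℝ} (hf : Measurable f) {c : ℝ} (hc : ∀ p, ‖f p‖ ≤ c) {F : Set Ω}
    (hF : MeasurableSet F) :
    ∫ ω in F, ∫ x, f (ω, x) ∂κ ω ∂P = ∫ p, (Prod.fst ⁻¹' F).indicator f p ∂(P.compProd κ) := by
  have hi : Integrable f (P.compProd κ) :=
    Integrable.of_bound hf.aestronglyMeasurable c (Eventually.of_forall hc)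
  have h := Measure.setIntegral_compProd (μ := P) (κ := κ) hF MeasurableSet.univ hi.integrableOn
  simp only [Measure.restrict_univ] at h
  rw [integral_indicator (measurable_fst hF), ← h, Set.prod_univ]

/-- The midpoint of two kernels. -/
def midKernel (κ η : Kernel Ω X) : Kernel Ω X where
  toFun ω := (2⁻¹ : ENNReal) • (κ ω + η ω)
  measurable' := Measure.measurable_of_measurable_coe _ fun _ hs =>
    ((κ.measurable_coe hs).add (η.measurable_coe hs)).const_mul _

lemma midKernel_apply (κ η : Kernel Ω X) (ω : Ω) :
    midKernel κ η ω = (2⁻¹ : ENNReal) • (κ ω + η ω) := rfl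

lemma isMarkovKernel_midKernel (κ η : Kernel Ω X) [IsMarkovKernel κ] [IsMarkovKernel η] :
    IsMarkovKernel (midKernel κ η) := by
  refine ⟨fun ω => ⟨?_⟩⟩
  rw [midKernel_apply, Measure.smul_apply, Measure.add_apply, measure_univ, measure_univ,
    one_add_one_eq_two, smul_eq_mul, ENNReal.inv_mul_cancel two_ne_zero ENNReal.ofNat_ne_top]

lemma integral_midKernel (κ η : Kernel Ω X) [IsMarkovKernel κ] [IsMarkovKernel η] {f : X → ℝ}
    (hf : Measurable f) {c : ℝ} (hc : ∀ x, ‖f x‖ ≤ c) (ω : Ω) :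
    ∫ x, f x ∂midKernel κ η ω = 2⁻¹ * (∫ x, f x ∂κ ω + ∫ x, f x ∂η ω) := by
  have hi : ∀ μ : Measure X, IsProbabilityMeasure μ → Integrable f μ := fun μ _ =>
    Integrable.of_bound hf.aestronglyMeasurable c (Eventually.of_forall hc)
  rw [midKernel_apply, integral_smul_measure,
    integral_add_measure (hi _ inferInstance) (hi _ inferInstance)]
  simp

lemma setIntegral_midKernel [IsFiniteMeasure P] (κ η : Kernel Ω X) [IsMarkovKernel κ]
    [IsMarkovKernel η] {f : Ω × X → ℝ} (hf : Measurable f) {c : ℝ} (hc : ∀ p, ‖f p‖ ≤ c)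
    (F : Set Ω) : ∫ ω in F, ∫ x, f (ω, x) ∂midKernel κ η ω ∂P =
      2⁻¹ * (∫ ω in F, ∫ x, f (ω, x) ∂κ ω ∂P + ∫ ω in F, ∫ x, f (ω, x) ∂η ω ∂P) := by
  rw [← integral_add (integrable_integral_kernel hf hc).integrableOn
    (integrable_integral_kernel hf hc).integrableOn, ← integral_const_mul]
  congr 1
  funext ω
  exact integral_midKernel κ η (hf.comp measurable_prodMk_left) (fun x => hc _) ω

end Kernel

variable {Ω : Type*} [MeasurableSpace Ω] {P : Measure Ω} {ϑ : Ω → Ω} {X : Type*}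

section Empirical

variable [TopologicalSpace X] [MeasurableSpace X] {R : TotalRDS P ϑ X} {s : Ω → X}

/-- The empirical measure along the orbits of a measurable section. -/
def empirical (R : TotalRDS P ϑ X) (s : Ω → X) (n : ℕ) : Measure (Ω × X) :=
  (n : ENNReal)⁻¹ • ∑ i ∈ Finset.range n, (P.map fun ω => (ω, s ω)).map R.skew^[i]

lemma empirical_apply (hϑ : Measurable ϑ) (hs : Measurable s) (n : ℕ) {A : Set (Ω × X)}
    (hA : MeasurableSet A) : R.empirical s n A =
      (n : ENNReal)⁻¹ * ∑ i ∈ Finset.range n, P {ω | R.skew^[i] (ω, s ω) ∈ A} := by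
  have hi := fun i => (R.measurable_skew hϑ).iterate i
  have hs' : Measurable fun ω => (ω, s ω) := measurable_id.prodMk hs
  simp only [empirical, Measure.smul_apply, Measure.finsetSum_apply, smul_eq_mul]
  congr 1
  refine Finset.sum_congr rfl fun i _ => ?_
  rw [Measure.map_apply (hi i) hA, Measure.map_apply hs' (hi i hA)]
  rfl

lemma isProbabilityMeasure_empirical [IsProbabilityMeasure P] (hϑ : Measurable ϑ)
    (hs : Measurable s) {n : ℕ} (hn : 0 < n) : IsProbabilityMeasure (R.empirical s n) := by
  refine ⟨?_⟩
  rw [empirical_apply hϑ hs n MeasurableSet.univ]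
  simp only [Set.mem_univ, Set.ofPred_true, measure_univ, Finset.sum_const, Finset.card_range,
    nsmul_eq_mul, mul_one]
  exact ENNReal.inv_mul_cancel (by exact_mod_cast hn.ne') (ENNReal.natCast_ne_top n)

lemma fst_empirical [IsProbabilityMeasure P] (hϑ : MeasurePreserving ϑ P P)
    (hs : Measurable s) {n : ℕ} (hn : 0 < n) : (R.empirical s n).fst = P := by
  ext A hA
  rw [Measure.fst_apply hA, empirical_apply hϑ.measurable hs n (measurable_fst hA)]
  have h1 : ∀ i, P {ω | R.skew^[i] (ω, s ω) ∈ (Prod.fst ⁻¹' A : Set (Ω × X))} = P A := fun i => by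
    rw [← (hϑ.iterate i).measure_preimage hA.nullMeasurableSet]
    congr 1
    ext ω
    change (R.skew^[i] (ω, s ω)).1 ∈ A ↔ _
    rw [iterate_skew_fst]
    rfl
  simp only [h1, Finset.sum_const, Finset.card_range, nsmul_eq_mul]
  rw [← mul_assoc, ENNReal.inv_mul_cancel (by exact_mod_cast hn.ne') (ENNReal.natCast_ne_top n),
    one_mul]

lemma ae_empirical_mem_carrier (hϑ : Measurable ϑ) (hs : Measurable s)
    (hsR : ∀ ω, (ω, s ω) ∈ R.carrier) (n : ℕ) : ∀ᵐ p ∂(R.empirical s n), p ∈ R.carrier := by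
  rw [ae_iff]
  change R.empirical s n R.carrierᶜ = 0
  rw [empirical_apply hϑ hs n R.measurableSet_carrier.compl]
  have h1 : ∀ i, {ω | R.skew^[i] (ω, s ω) ∈ R.carrierᶜ} = ∅ := fun i =>
    Set.eq_empty_of_forall_notMem fun ω hω => hω (R.iterate_skew_mem (hsR ω) i)
  simp only [h1, measure_empty, Finset.sum_const_zero, mul_zero]

lemma integral_empirical [IsProbabilityMeasure P] (hϑ : Measurable ϑ) (hs : Measurable s) (n : ℕ)
    {h : Ω × X → ℝ} (hm : Measurable h) {c : ℝ} (hc : ∀ p, ‖h p‖ ≤ c) :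
    ∫ p, h p ∂(R.empirical s n) =
      (n : ℝ)⁻¹ * ∑ i ∈ Finset.range n, ∫ ω, h (R.skew^[i] (ω, s ω)) ∂P := by
  have hi := fun i => (R.measurable_skew hϑ).iterate i
  have hs' : Measurable fun ω => (ω, s ω) := measurable_id.prodMk hs
  rw [empirical, integral_smul_measure, integral_finsetSum_measure]
  · simp only [ENNReal.toReal_inv, ENNReal.toReal_natCast, smul_eq_mul]
    congr 1
    refine Finset.sum_congr rfl fun i _ => ?_
    rw [integral_map (hi i).aemeasurable hm.aestronglyMeasurable,
      integral_map (f := fun p => h (R.skew^[i] p)) hs'.aemeasurable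
        (hm.comp (hi i)).aestronglyMeasurable]
  · intro i _
    exact Integrable.of_bound hm.aestronglyMeasurable c (Eventually.of_forall hc)

/-- The sum along the orbit telescopes to two boundary terms, each at most `c`. -/
lemma abs_integral_comp_skew_sub_le [IsProbabilityMeasure P] (hϑ : Measurable ϑ)
    (hs : Measurable s) (n : ℕ) {h : Ω × X → ℝ} (hm : Measurable h) {c : ℝ}
    (hc : ∀ p, ‖h p‖ ≤ c) :
    |∫ p, h (R.skew p) ∂(R.empirical s n) - ∫ p, h p ∂(R.empirical s n)| ≤ 2 / n * c := by
  rw [integral_empirical (h := fun p => h (R.skew p)) hϑ hs n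
      (hm.comp (R.measurable_skew hϑ)) (fun p => hc _),
    integral_empirical hϑ hs n hm hc, ← mul_sub, ← Finset.sum_sub_distrib]
  simp only [← Function.iterate_succ_apply']
  rw [Finset.sum_range_sub fun i => ∫ ω, h (R.skew^[i] (ω, s ω)) ∂P, abs_mul,
    abs_of_nonneg (by positivity : (0 : ℝ) ≤ (n : ℝ)⁻¹)]
  have h1 : ∀ i, |∫ ω, h (R.skew^[i] (ω, s ω)) ∂P| ≤ c := fun i => by
    have := norm_integral_le_of_norm_le_const (μ := P) (f := fun ω => h (R.skew^[i] (ω, s ω)))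
      (C := c) (Eventually.of_forall fun ω => hc _)
    simpa using this
  calc (n : ℝ)⁻¹ * |∫ ω, h (R.skew^[n] (ω, s ω)) ∂P - ∫ ω, h (R.skew^[0] (ω, s ω)) ∂P|
      ≤ (n : ℝ)⁻¹ * (c + c) := by
        gcongr
        exact (abs_sub _ _).trans (add_le_add (h1 _) (h1 _))
    _ = 2 / n * c := by ring

end Empirical

variable [MetricSpace X] [CompactSpace X] [MeasurableSpace X]

/-- The disintegrations of the measures on the bundle that are invariant up to `ε` and give mass
at least `a - ε` to `E`. -/
def nearlyInvariant (R : TotalRDS P ϑ X) (E : Set X) (a ε : ℝ) : Set (Kernel Ω X) :=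
  {κ | IsMarkovKernel κ ∧ (∀ᵐ ω ∂P, ∀ᵐ x ∂κ ω, (ω, x) ∈ R.carrier) ∧
    a - ε ≤ ∫ ω, (κ ω).real E ∂P ∧ ∀ F, MeasurableSet F → ∀ g : C(X, ℝ),
      |∫ ω in ϑ ⁻¹' F, ∫ x, g (R.T (ω, x)) ∂κ ω ∂P - ∫ ω in F, ∫ x, g x ∂κ ω ∂P| ≤ ε * ‖g‖}

variable {R : TotalRDS P ϑ X} {E : Set X}

lemma nearlyInvariant_mono (a : ℝ) : Monotone (R.nearlyInvariant E a) := by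
  rintro ε δ h κ ⟨h1, h2, h3, h4⟩
  exact ⟨h1, h2, by linarith, fun F hF g => (h4 F hF g).trans (by gcongr)⟩

variable [BorelSpace X]

/-- The support condition passes to sums, the integrals are affine in the kernel, and the bounds are
convex. -/
lemma midKernel_mem_nearlyInvariant [IsProbabilityMeasure P] (hE : MeasurableSet E) {a ε : ℝ}
    {κ η : Kernel Ω X} (hκ : κ ∈ R.nearlyInvariant E a ε) (hη : η ∈ R.nearlyInvariant E a ε) :
    midKernel κ η ∈ R.nearlyInvariant E a ε := by
  obtain ⟨_, h2, h3, h4⟩ := hκ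
  obtain ⟨_, h2', h3', h4'⟩ := hη
  refine ⟨isMarkovKernel_midKernel κ η, ?_, ?_, fun F hF g => ?_⟩
  · filter_upwards [h2, h2'] with ω hω hω'
    rw [midKernel_apply]
    exact Measure.ae_smul_measure (ae_add_measure_iff.2 ⟨hω, hω'⟩) _
  · have h1 : ∀ κ : Kernel Ω X, ∀ ω, (κ ω).real E =
        ∫ x, (fun p : Ω × X => E.indicator (fun _ => (1 : ℝ)) p.2) (ω, x) ∂κ ω := fun κ ω => by
      simp [integral_indicator hE]
    have hm : Measurable fun p : Ω × X => E.indicator (fun _ => (1 : ℝ)) p.2 :=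
      (measurable_const.indicator hE).comp measurable_snd
    have hb : ∀ p : Ω × X, ‖E.indicator (fun _ => (1 : ℝ)) p.2‖ ≤ 1 := fun p => by
      by_cases hp : p.2 ∈ E <;> simp [hp]
    have := setIntegral_midKernel (P := P) κ η hm hb Set.univ
    simp only [Measure.restrict_univ] at this
    simp only [h1] at h3 h3' ⊢
    rw [this]
    linarith
  · have hm1 : Measurable fun p : Ω × X => g (R.T p) := g.continuous.measurable.comp R.measurable_T
    have hm2 : Measurable fun p : Ω × X => g p.2 := g.continuous.measurable.comp measurable_snd
    rw [setIntegral_midKernel (P := P) κ η hm1 (fun p => g.norm_coe_le_norm _),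
      setIntegral_midKernel (P := P) κ η hm2 (fun p => g.norm_coe_le_norm _)]
    have h5 := h4 F hF g
    have h6 := h4' F hF g
    rw [abs_le] at h5 h6 ⊢
    constructor <;> linarith [h5.1, h5.2, h6.1, h6.2]

/-- The witness disintegrates the empirical measure of a section maximizing visits before time `n`:
its mass on `E` is `(∫ maxVisits) / n`, and its defect of invariance is at most `2 / n`. -/
lemma exists_mem_nearlyInvariant [IsProbabilityMeasure P] [P.IsComplete]
    (hϑ : MeasurePreserving ϑ P P) (hE : IsClosed E) {n : ℕ} (hn : 0 < n) {a ε : ℝ}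
    (ha : a - ε ≤ (∫ ω, R.maxVisits E n ω ∂P) / n) (hε : 2 / n ≤ ε) :
    (R.nearlyInvariant E a ε).Nonempty := by
  obtain ⟨s, hs, hsR, hmax⟩ := R.exists_section_maxVisits hϑ hE n
  have hpr := R.isProbabilityMeasure_empirical hϑ.measurable hs hn
  have hX : Nonempty X := by
    obtain ⟨ω, -⟩ := hmax.exists
    exact ⟨s ω⟩
  let μ := R.empirical s n
  let κ : Kernel Ω X := μ.condKernel
  have hκ : P.compProd κ = μ := by
    have := μ.disintegrate μ.condKernel
    rwa [R.fst_empirical hϑ hs hn] at this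
  refine ⟨κ, inferInstance, ?_, ?_, fun F hF g => ?_⟩
  · refine Measure.ae_ae_of_ae_compProd ?_
    rw [hκ]
    exact R.ae_empirical_mem_carrier hϑ.measurable hs hsR n
  · have hm : Measurable fun p : Ω × X => E.indicator (fun _ => (1 : ℝ)) p.2 :=
      (measurable_const.indicator hE.measurableSet).comp measurable_snd
    have hb : ∀ p : Ω × X, ‖E.indicator (fun _ => (1 : ℝ)) p.2‖ ≤ 1 := fun p => by
      by_cases hp : p.2 ∈ E <;> simp [hp]
    have h1 : ∀ ω, (κ ω).real E = ∫ x, E.indicator (fun _ => (1 : ℝ)) x ∂κ ω := fun ω => by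
      simp [integral_indicator hE.measurableSet]
    have h2 := setIntegral_integral_kernel (P := P) (κ := κ) hm hb MeasurableSet.univ
    simp only [Measure.restrict_univ, Set.preimage_univ, Set.indicator_univ, hκ] at h2
    simp only [h1, h2]
    refine ha.trans (le_of_eq ?_)
    rw [R.integral_empirical hϑ.measurable hs n hm hb, ← integral_finsetSum]
    · rw [div_eq_inv_mul]
      congr 1
      refine integral_congr_ae ?_
      filter_upwards [hmax] with ω hω
      exact hω.symm
    · intro i _
      refine Integrable.of_bound (hm.comp (((R.measurable_skew hϑ.measurable).iterate i).comp
        (measurable_id.prodMk hs))).aestronglyMeasurable 1 (Eventually.of_forall fun ω => hb _)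
  · have hm1 : Measurable fun p : Ω × X => g (R.T p) := g.continuous.measurable.comp R.measurable_T
    have hm2 : Measurable fun p : Ω × X => g p.2 := g.continuous.measurable.comp measurable_snd
    rw [setIntegral_integral_kernel (P := P) hm1 (fun p => g.norm_coe_le_norm _)
        (hϑ.measurable hF),
      setIntegral_integral_kernel (P := P) hm2 (fun p => g.norm_coe_le_norm _) hF, hκ]
    have h3 := R.abs_integral_comp_skew_sub_le (s := s) hϑ.measurable hs n
      (h := (Prod.fst ⁻¹' F).indicator fun p : Ω × X => g p.2)
      (hm2.indicator (measurable_fst hF)) (c := ‖g‖)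
      (fun p => (norm_indicator_le_norm_self _ _).trans (g.norm_coe_le_norm _))
    exact h3.trans (by gcongr)

end TotalRDS

/-! ### Passage to the limit and the variational principle -/

open ProbabilityTheory

lemma limsup_measure_isClosed_le {X : Type*} [MetricSpace X] [CompactSpace X] [MeasurableSpace X]
    [BorelSpace X] {μ : ℕ → Measure X} {ν : Measure X} [∀ n, IsProbabilityMeasure (μ n)]
    [IsProbabilityMeasure ν]
    (h : ∀ f : C(X, ℝ), Tendsto (fun n => ∫ x, f x ∂μ n) atTop (𝓝 (∫ x, f x ∂ν))) {A : Set X}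
    (hA : IsClosed A) : limsup (fun n => μ n A) atTop ≤ ν A := by
  let p : ℕ → ProbabilityMeasure X := fun n => ⟨μ n, inferInstance⟩
  let q : ProbabilityMeasure X := ⟨ν, inferInstance⟩
  have h1 : Tendsto p atTop (𝓝 q) :=
    ProbabilityMeasure.tendsto_iff_forall_integral_tendsto.2 fun f => h f.toContinuousMap
  exact ProbabilityMeasure.limsup_measure_closed_le_of_tendsto h1 hA

lemma ae_mem_of_isClosed {X : Type*} [MetricSpace X] [CompactSpace X] [MeasurableSpace X]
    [BorelSpace X] {μ : ℕ → Measure X} {ν : Measure X} [∀ n, IsProbabilityMeasure (μ n)]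
    [IsProbabilityMeasure ν]
    (h : ∀ f : C(X, ℝ), Tendsto (fun n => ∫ x, f x ∂μ n) atTop (𝓝 (∫ x, f x ∂ν))) {A : Set X}
    (hA : IsClosed A) (hμ : ∀ n, ∀ᵐ x ∂μ n, x ∈ A) : ∀ᵐ x ∂ν, x ∈ A := by
  have h1 := limsup_measure_isClosed_le h hA
  have h2 : ∀ n, μ n A = 1 := fun n => (prob_compl_eq_zero_iff hA.measurableSet).1 (hμ n)
  simp only [h2, limsup_const] at h1
  exact (prob_compl_eq_zero_iff hA.measurableSet).2 (le_antisymm prob_le_one h1)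

/-- Weak convergence of measures supported on a closed set applies to functions that are continuous
on that set. -/
lemma tendsto_integral_of_continuousOn {X : Type*} [MetricSpace X] [CompactSpace X]
    [MeasurableSpace X] [BorelSpace X] {μ : ℕ → Measure X} {ν : Measure X}
    [∀ n, IsProbabilityMeasure (μ n)] [IsProbabilityMeasure ν]
    (h : ∀ f : C(X, ℝ), Tendsto (fun n => ∫ x, f x ∂μ n) atTop (𝓝 (∫ x, f x ∂ν))) {A : Set X}
    (hA : IsClosed A) (hμ : ∀ n, ∀ᵐ x ∂μ n, x ∈ A) {f : X → ℝ} (hf : ContinuousOn f A) :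
    Tendsto (fun n => ∫ x, f x ∂μ n) atTop (𝓝 (∫ x, f x ∂ν)) := by
  -- Tietze extension from the closed set `A`, which carries all the measures, including the limit.
  obtain ⟨g, hg⟩ := ContinuousMap.exists_restrict_eq hA
    (⟨A.domRestrict f, continuousOn_iff_continuous_domRestrict.1 hf⟩ : C(A, ℝ))
  have hgf : ∀ x ∈ A, f x = g x := fun x hx => (DFunLike.congr_fun hg ⟨x, hx⟩).symm
  have h1 : ∀ n, ∫ x, f x ∂μ n = ∫ x, g x ∂μ n := fun n =>
    integral_congr_ae ((hμ n).mono fun x hx => hgf x hx)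
  have h2 : ∫ x, f x ∂ν = ∫ x, g x ∂ν :=
    integral_congr_ae ((ae_mem_of_isClosed h hA hμ).mono fun x hx => hgf x hx)
  simpa only [h1, h2] using h g

namespace TotalRDS

variable {Ω : Type*} [MeasurableSpace Ω] {P : Measure Ω} [IsProbabilityMeasure P] {ϑ : Ω → Ω}
  {X : Type*} [MetricSpace X] [MeasurableSpace X] [BorelSpace X]
  {R : TotalRDS P ϑ X} {E : Set X}

/-- Finite measures on the product are determined by rectangles. For fixed `F`, the measures `B ↦ μ
(F ×ˢ B)` on `X` are determined by continuous functions. -/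
lemma map_skew_compProd_eq (hϑ : Measurable ϑ) {κ : Kernel Ω X} [IsMarkovKernel κ]
    (h : ∀ F, MeasurableSet F → ∀ g : C(X, ℝ),
      ∫ ω in ϑ ⁻¹' F, ∫ x, g (R.T (ω, x)) ∂κ ω ∂P = ∫ ω in F, ∫ x, g x ∂κ ω ∂P) :
    (P.compProd κ).map R.skew = P.compProd κ := by
  have hskew := R.measurable_skew hϑ
  have hpr : IsProbabilityMeasure ((P.compProd κ).map R.skew) :=
    Measure.isProbabilityMeasure_map hskew.aemeasurable
  refine Measure.ext_prod fun {F} {B} hF hB => ?_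
  let ν : Measure (Ω × X) → Measure X := fun μ => (μ.restrict (Prod.fst ⁻¹' F)).map Prod.snd
  have hν : ∀ μ : Measure (Ω × X), μ (F ×ˢ B) = ν μ B := fun μ => by
    rw [Measure.map_apply measurable_snd hB, Measure.restrict_apply (measurable_snd hB),
      Set.inter_comm]
    rfl
  suffices ν ((P.compProd κ).map R.skew) = ν (P.compProd κ) by rw [hν, hν, this]
  refine ext_of_forall_integral_eq_of_IsFiniteMeasure fun g => ?_
  have hm : Measurable fun p : Ω × X => g p.2 := g.continuous.measurable.comp measurable_snd
  have hm' : Measurable fun p : Ω × X => g (R.T p) := g.continuous.measurable.comp R.measurable_T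
  rw [integral_map measurable_snd.aemeasurable g.continuous.measurable.aestronglyMeasurable,
    integral_map measurable_snd.aemeasurable g.continuous.measurable.aestronglyMeasurable,
    setIntegral_map (measurable_fst hF) hm.aestronglyMeasurable hskew.aemeasurable]
  have h1 := setIntegral_integral_kernel (P := P) (κ := κ) hm' (fun p => g.norm_coe_le_norm _)
    (hϑ hF)
  have h2 := setIntegral_integral_kernel (P := P) (κ := κ) hm (fun p => g.norm_coe_le_norm _) hF
  rw [integral_indicator (measurable_fst (hϑ hF))] at h1
  rw [integral_indicator (measurable_fst hF)] at h2
  exact (h1.symm.trans (h F hF g.toContinuousMap)).trans h2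

variable [CompactSpace X]

/-- Existence of invariant measures, as limits of nearly invariant ones. -/
theorem exists_invariant_of_nearlyInvariant (hϑ : Measurable ϑ) (hE : IsClosed E) {a : ℝ}
    (h : ∀ ε > 0, (R.nearlyInvariant E a ε).Nonempty) :
    ∃ μ : Measure (Ω × X), IsProbabilityMeasure μ ∧ μ.map Prod.fst = P ∧
      (∀ᵐ p ∂μ, p ∈ R.carrier) ∧ MeasurePreserving R.skew μ μ ∧ a ≤ μ.real (Set.univ ×ˢ E) := by
  let e : ℕ → ℝ := fun n => 1 / ((n : ℝ) + 1)
  have he0 : Tendsto e atTop (𝓝 0) := tendsto_one_div_add_atTop_nhds_zero_nat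
  have he : Antitone e := fun n m hnm => by
    simp only [e]
    gcongr
  obtain ⟨κ, hκ, η, hη, hlim⟩ := exists_kernel_tendsto_of_midpoint_mem P
    (K := fun n => R.nearlyInvariant E a (e n))
    (fun n m hnm => nearlyInvariant_mono a (he hnm)) (fun n => h _ (by positivity))
    (fun n κ hκ => hκ.1)
    (fun n κ hκ η hη => ⟨midKernel κ η, midKernel_mem_nearlyInvariant hE.measurableSet hκ hη,
      midKernel_apply κ η⟩)
  have hmk : ∀ n, IsMarkovKernel (κ n) := fun n => (hκ n).1
  have hsupp : ∀ᵐ ω ∂P, ∀ n, ∀ᵐ x ∂κ n ω, (ω, x) ∈ R.carrier :=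
    ae_all_iff.2 fun n => (hκ n).2.1
  refine ⟨P.compProd η, inferInstance, Measure.fst_compProd P η, ?_,
    ⟨R.measurable_skew hϑ, map_skew_compProd_eq hϑ fun F hF g => ?_⟩, ?_⟩
  · refine Measure.ae_compProd_of_ae_ae R.measurableSet_carrier ?_
    filter_upwards [hlim, hsupp] with ω h1 h2
    exact ae_mem_of_isClosed h1 (R.isCompact_fiber ω).isClosed h2
  · have hm1 : Measurable fun p : Ω × X => g (R.T p) := g.continuous.measurable.comp R.measurable_T
    have hm2 : Measurable fun p : Ω × X => g p.2 := g.continuous.measurable.comp measurable_snd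
    have h1 : Tendsto (fun n => ∫ ω in ϑ ⁻¹' F, ∫ x, g (R.T (ω, x)) ∂κ n ω ∂P) atTop
        (𝓝 (∫ ω in ϑ ⁻¹' F, ∫ x, g (R.T (ω, x)) ∂η ω ∂P)) := by
      refine tendsto_integral_of_dominated_convergence (fun _ => ‖g‖)
        (fun n => (measurable_integral_kernel hm1).aestronglyMeasurable) (integrable_const _)
        (fun n => Eventually.of_forall fun ω =>
          norm_integral_kernel_le (f := fun p => g (R.T p)) (fun p => g.norm_coe_le_norm _) ω) ?_
      refine ae_restrict_of_ae ?_
      filter_upwards [hlim, hsupp, R.continuousOn_T] with ω h1 h2 h3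
      -- `g ∘ T ω` is continuous only on the fiber, which suffices because the kernels are supported
      -- there.
      exact tendsto_integral_of_continuousOn h1 (R.isCompact_fiber ω).isClosed h2
        (g.continuous.comp_continuousOn h3)
    have h2 : Tendsto (fun n => ∫ ω in F, ∫ x, g x ∂κ n ω ∂P) atTop
        (𝓝 (∫ ω in F, ∫ x, g x ∂η ω ∂P)) := by
      refine tendsto_integral_of_dominated_convergence (fun _ => ‖g‖)
        (fun n => (measurable_integral_kernel hm2).aestronglyMeasurable) (integrable_const _)
        (fun n => Eventually.of_forall fun ω =>
          norm_integral_kernel_le (f := fun p => g p.2) (fun p => g.norm_coe_le_norm _) ω) ?_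
      refine ae_restrict_of_ae ?_
      filter_upwards [hlim] with ω h1
      exact h1 g
    have h3 : Tendsto (fun n => e n * ‖g‖) atTop (𝓝 0) := by simpa using he0.mul_const ‖g‖
    have h4 := squeeze_zero_norm
      (fun n => (Real.norm_eq_abs _).le.trans ((hκ n).2.2.2 F hF g)) h3
    exact sub_eq_zero.1 (tendsto_nhds_unique (h1.sub h2) h4)
  · have hset : (P.compProd η) (Set.univ ×ˢ E) = ∫⁻ ω, η ω E ∂P := by
      rw [Measure.compProd_apply_prod MeasurableSet.univ hE.measurableSet, Measure.restrict_univ]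
    -- Reverse Fatou in `ω`, followed by the portmanteau inequality for the closed set `E` in each
    -- fiber.
    have h1 : limsup (fun n => ∫⁻ ω, κ n ω E ∂P) atTop ≤ ∫⁻ ω, limsup (fun n => κ n ω E) atTop ∂P :=
      limsup_lintegral_le (fun _ => 1) (fun n => (κ n).measurable_coe hE.measurableSet)
        (fun n => Eventually.of_forall fun ω => prob_le_one) (by simp)
    have h2 : ∫⁻ ω, limsup (fun n => κ n ω E) atTop ∂P ≤ ∫⁻ ω, η ω E ∂P := by
      refine lintegral_mono_ae ?_
      filter_upwards [hlim] with ω hω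
      exact limsup_measure_isClosed_le hω hE
    have h3 : ∀ n, ENNReal.ofReal (a - e n) ≤ ∫⁻ ω, κ n ω E ∂P := fun n => by
      refine ENNReal.ofReal_le_of_le_toReal ((hκ n).2.2.1.trans (le_of_eq ?_))
      exact integral_toReal ((κ n).measurable_coe hE.measurableSet).aemeasurable
        (Eventually.of_forall fun ω => measure_lt_top _ _)
    have h4 : Tendsto (fun n => ENNReal.ofReal (a - e n)) atTop (𝓝 (ENNReal.ofReal a)) := by
      refine ENNReal.tendsto_ofReal ?_
      simpa using tendsto_const_nhds.sub he0
    have h5 : ENNReal.ofReal a ≤ (P.compProd η) (Set.univ ×ˢ E) := by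
      rw [hset, ← h4.limsup_eq]
      exact (limsup_le_limsup (Eventually.of_forall h3)).trans (h1.trans h2)
    exact (ENNReal.ofReal_le_iff_le_toReal (measure_ne_top _ _)).1 h5

/-- The variational principle for the mean maximal frequency of visits to a closed set. -/
theorem isLUB_integral_lowerRate [P.IsComplete] (hϑ : MeasurePreserving ϑ P P) (hE : IsClosed E) :
    IsLUB ((fun μ : Measure (Ω × X) => μ.real (Set.univ ×ˢ E)) ''
      {μ | IsProbabilityMeasure μ ∧ μ.map Prod.fst = P ∧ (∀ᵐ p ∂μ, p ∈ R.carrier) ∧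
        MeasurePreserving R.skew μ μ}) (∫ ω, lowerRate (R.maxVisits E) ω ∂P) := by
  have hb := R.boundedSubadditive_maxVisits hϑ.measurable hE.measurableSet
  have hlim : Tendsto (fun n : ℕ => (∫ ω, R.maxVisits E n ω ∂P) / n) atTop
      (𝓝 (∫ ω, lowerRate (R.maxVisits E) ω ∂P)) := by
    simp only [← integral_div]
    refine tendsto_integral_of_dominated_convergence (fun _ => 1)
      (fun n => ((hb.measurable n).div_const _).aestronglyMeasurable) (integrable_const _)
      (fun n => Eventually.of_forall fun ω => ?_) (hb.ae_tendsto hϑ)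
    rw [Real.norm_of_nonneg (hb.div_nonneg n ω)]
    exact hb.div_le_one n ω
  refine isLUB_iff_le_iff.2 fun c => ⟨fun hc => ?_, fun hc => ?_⟩
  · rintro _ ⟨μ, ⟨hμ, hfst, hcar, hinv⟩, rfl⟩
    refine le_trans (ge_of_tendsto hlim ?_) hc
    filter_upwards [eventually_gt_atTop 0] with n hn
    rw [le_div_iff₀ (by exact_mod_cast hn), mul_comm]
    exact measureReal_le_integral_maxVisits hϑ.measurable hE.measurableSet hfst hcar hinv n
  -- The value is attained: `n` is taken so large that the mean frequency exceeds the limit minus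
  -- `ε` and `2 / n < ε`.
  · obtain ⟨μ, h1, h2, h3, h4, h5⟩ := R.exists_invariant_of_nearlyInvariant hϑ.measurable hE
      (a := ∫ ω, lowerRate (R.maxVisits E) ω ∂P) fun ε hε => by
        obtain ⟨n, hn1, hn2, hn3⟩ := ((hlim.eventually (lt_mem_nhds (sub_lt_self _ hε))).and
          (((tendsto_const_div_atTop_nhds_zero_nat (2 : ℝ)).eventually (gt_mem_nhds hε)).and
            (eventually_gt_atTop 0))).exists
        exact exists_mem_nearlyInvariant hϑ hE hn3 hn1.le hn2.le
    exact h5.trans (hc ⟨μ, ⟨h1, h2, h3, h4⟩, rfl⟩)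

end TotalRDS

/-! ### Transfer to the bundle -/

namespace BundleRDS

variable {Ω : Type*} [MeasurableSpace Ω] {P : Measure Ω} {ϑ : Ω → Ω}
  {X : Type*} [TopologicalSpace X] [MeasurableSpace X]

open Classical in
/-- Extension of the fiber maps to the whole product space by the second projection. -/
def toTotal (R : BundleRDS P ϑ X) : TotalRDS P ϑ X where
  carrier := R.carrier
  measurableSet_carrier := R.measurableSet_carrier
  nonempty_fiber := R.nonempty_fiber
  isCompact_fiber := R.isCompact_fiber
  T p := if h : p ∈ R.carrier then R.T p.1 ⟨p.2, h⟩ else p.2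
  measurable_T := Measurable.dite (s := R.carrier)
    (f := fun p : R.carrier => (R.T p.1.1 ⟨p.1.2, p.2⟩ : X))
    (g := fun p : (R.carrierᶜ : Set (Ω × X)) => p.1.2) R.measurable_T
    (measurable_snd.comp measurable_subtype_coe) R.measurableSet_carrier
  mapsTo p hp := by
    rw [dif_pos hp]
    exact (R.T p.1 ⟨p.2, hp⟩).2
  continuousOn_T := by
    filter_upwards [R.continuous_T] with ω hω
    rw [continuousOn_iff_continuous_domRestrict]
    convert continuous_subtype_val.comp hω using 1
    funext x
    exact dif_pos x.2

variable (R : BundleRDS P ϑ X)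

lemma toTotal_skew_coe (p : R.carrier) : R.toTotal.skew p = R.skew p := by
  refine Prod.ext rfl ?_
  exact dif_pos p.2

lemma iterate_toTotal_skew_coe (p : R.carrier) (i : ℕ) :
    R.toTotal.skew^[i] p = (R.skew^[i] p : R.carrier) := by
  induction i generalizing p with
  | zero => rfl
  | succ i ih => rw [Function.iterate_succ_apply, Function.iterate_succ_apply, toTotal_skew_coe, ih]

lemma iter_eq_iterate_skew (i : ℕ) (ω : Ω) (x : R.fiber ω) :
    (R.iter i ω x : X) = (R.skew^[i] ⟨(ω, x), x.2⟩).1.2 := by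
  induction i generalizing ω with
  | zero => rfl
  | succ i ih => exact ih (ϑ ω) (R.T ω x)

lemma orbitFreq_eq_maxVisits_div (E : Set X) (n : ℕ) (ω : Ω) :
    R.orbitFreq E n ω = R.toTotal.maxVisits E n ω / n := by
  rw [orbitFreq, one_div_mul_eq_div]
  congr 1
  refine iSup_congr fun x => Finset.sum_congr rfl fun i _ => ?_
  rw [iter_eq_iterate_skew, ← iterate_toTotal_skew_coe]

lemma comap_map_coe {μ : Measure (Ω × X)} (hc : ∀ᵐ p ∂μ, p ∈ R.carrier) :
    (μ.comap (Subtype.val : R.carrier → Ω × X)).map Subtype.val = μ := by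
  rw [(MeasurableEmbedding.subtype_coe R.measurableSet_carrier).map_comap, Subtype.range_coe]
  exact Measure.restrict_eq_self_of_ae_mem hc

/-- The inclusion of the bundle intertwines the two skew products, and restricting `μ` to the bundle
and pushing it back returns `μ`. -/
lemma measurePreserving_skew_iff {μ : Measure (Ω × X)} (hϑ : Measurable ϑ)
    (hc : ∀ᵐ p ∂μ, p ∈ R.carrier) :
    MeasurePreserving R.skew (μ.comap (Subtype.val : R.carrier → Ω × X))
      (μ.comap (Subtype.val : R.carrier → Ω × X)) ↔ MeasurePreserving R.toTotal.skew μ μ := by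
  have hemb := MeasurableEmbedding.subtype_coe R.measurableSet_carrier
  have hm := R.toTotal.measurable_skew hϑ
  have hcomp : R.toTotal.skew ∘ (Subtype.val : R.carrier → Ω × X) = Subtype.val ∘ R.skew :=
    funext R.toTotal_skew_coe
  have hmskew : Measurable R.skew := by
    rw [← hemb.measurable_comp_iff, ← hcomp]
    exact hm.comp measurable_subtype_coe
  have key : μ.map R.toTotal.skew =
      ((μ.comap (Subtype.val : R.carrier → Ω × X)).map R.skew).map Subtype.val := by
    rw [Measure.map_map measurable_subtype_coe hmskew, ← hcomp,
      ← Measure.map_map hm measurable_subtype_coe, R.comap_map_coe hc]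
  constructor
  · intro h
    refine ⟨hm, ?_⟩
    rw [key, h.map_eq, R.comap_map_coe hc]
  · intro h
    refine ⟨hmskew, ?_⟩
    rw [← hemb.comap_map ((μ.comap (Subtype.val : R.carrier → Ω × X)).map R.skew), ← key, h.map_eq]

lemma invariantMeasures_eq (hϑ : Measurable ϑ) : R.invariantMeasures =
    {μ | IsProbabilityMeasure μ ∧ μ.map Prod.fst = P ∧ (∀ᵐ p ∂μ, p ∈ R.toTotal.carrier) ∧
        MeasurePreserving R.toTotal.skew μ μ} := by
  ext μ
  refine and_congr_right fun hμ => and_congr_right fun _ => ?_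
  have h1 : (∀ᵐ p ∂μ, p ∈ R.toTotal.carrier) ↔ μ R.carrier = 1 :=
    prob_compl_eq_zero_iff R.measurableSet_carrier
  rw [← h1]
  exact and_congr_right fun hc => R.measurePreserving_skew_iff hϑ hc

end BundleRDS

/-- Nonemptiness of the set of invariant measures is contained in the last clause, since the empty
set has no least upper bound in `ℝ`. -/
theorem mainTheorem5 {Ω : Type*} [MeasurableSpace Ω] (P : Measure Ω) [IsProbabilityMeasure P]
    [P.IsComplete] (ϑ : Ω → Ω) (hϑ : MeasurePreserving ϑ P P)
    {X : Type*} [MetricSpace X] [CompactSpace X] [MeasurableSpace X] [BorelSpace X]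
    (R : BundleRDS P ϑ X) (E : Set X) (hE : IsClosed E) :
    (∀ᵐ ω ∂P, Tendsto (fun n : ℕ => R.orbitFreq E n ω) atTop (𝓝 (R.ocap E ω))) ∧
    Integrable (R.ocap E) P ∧
    IsLUB ((fun μ : Measure (Ω × X) => μ.real (Set.univ ×ˢ E)) '' R.invariantMeasures)
      (∫ ω, R.ocap E ω ∂P) := by
  have hb := R.toTotal.boundedSubadditive_maxVisits hϑ.measurable hE.measurableSet
  have hlim : ∀ᵐ ω ∂P, Tendsto (fun n : ℕ => R.orbitFreq E n ω) atTop
      (𝓝 (lowerRate (R.toTotal.maxVisits E) ω)) := by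
    simpa only [R.orbitFreq_eq_maxVisits_div] using hb.ae_tendsto hϑ
  have hocap : R.ocap E =ᵐ[P] lowerRate (R.toTotal.maxVisits E) :=
    hlim.mono fun ω hω => hω.limUnder_eq
  refine ⟨?_, hb.integrable_lowerRate.congr hocap.symm, ?_⟩
  · filter_upwards [hlim, hocap] with ω h1 h2
    rwa [h2]
  · rw [integral_congr_ae hocap, R.invariantMeasures_eq hϑ.measurable]
    exact TotalRDS.isLUB_integral_lowerRate hϑ hE

end
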